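/- For real $a$ and complex $z$ let $U(a,z)$ be the parabolic cylinder function, i.e. the entire solution of $y''=\left(\tfrac14 z^2+a\right)y$ with $$U(a,0)=\frac{\sqrt{\pi}}{2^{\frac12 a+\frac14}\,\Gamma\left(\tfrac34+\tfrac12 a\right)},\qquad U'(a,0)=-\frac{\sqrt{\pi}}{2^{\frac12 a-\frac14}\,\Gamma\left(\tfrac14+\tfrac12 a\right)}$$ (with $1/\Gamma$ taken to be $0$ at the poles of $\Gamma$). For a positive integer $n$ and $z\neq 0$ define the remainder $R_n(a,z)$ of its large-argument Poincaré expansion by $$U(a,z)=z^{-a-\frac12}e^{-\frac14 z^2}\left\{\sum_{s=0}^{n-1}(-1)^s\frac{\left(a+\frac12\right)_{2s}}{s!\,(2z^2)^s}+R_n(a,z)\right\},$$ where $(x)_m=x(x+1)\cdots(x+m-1)$ is the Pochhammer symbol and $z^{-a-\frac12}$ has its principal value. Then for all real $a$ with $0\le|a|\le 10$ and all complex $z$ with $12\le|z|<\infty$ and $|\arg z|\le\pi/2$, $$\left|R_{35}(a,z)\right|<6.24\times10^{-14}.$$ -/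

import Mathlib

noncomputable section

namespace ParabolicCylinder

/-- The even solution of `y'' = (z²/4 + a) y` with `y(0) = 1`, `y'(0) = 0`:
`e^{-z²/4} (1 + (a+1/2) z²/2! + (a+1/2)(a+5/2) z⁴/4! + ⋯)`. -/
def u₁ (a z : ℂ) : ℂ :=
  Complex.exp (-z ^ 2 / 4) *
    ∑' k : ℕ, (∏ j ∈ Finset.range k, (a + 1 / 2 + 2 * (j : ℂ))) *
      z ^ (2 * k) / (Nat.factorial (2 * k) : ℂ)

/-- The odd solution of `y'' = (z²/4 + a) y` with `y(0) = 0`, `y'(0) = 1`: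
`e^{-z²/4} (z + (a+3/2) z³/3! + (a+3/2)(a+7/2) z⁵/5! + ⋯)`. -/
def u₂ (a z : ℂ) : ℂ :=
  Complex.exp (-z ^ 2 / 4) *
    ∑' k : ℕ, (∏ j ∈ Finset.range k, (a + 3 / 2 + 2 * (j : ℂ))) *
      z ^ (2 * k + 1) / (Nat.factorial (2 * k + 1) : ℂ)

/-- The value `U(a,0) = √π / (2^{a/2+1/4} Γ(3/4+a/2))`. At a pole of `Γ` this is `0`, in
agreement with the entire function `1/Γ`, because Mathlib sets `Γ = 0` there and `x / 0 = 0`. -/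
def UAtZero (a : ℂ) : ℂ :=
  (Real.sqrt Real.pi : ℂ) / ((2 : ℂ) ^ (a / 2 + 1 / 4) * Complex.Gamma (3 / 4 + a / 2))

/-- The value `U'(a,0) = -√π / (2^{a/2-1/4} Γ(1/4+a/2))`, with the same remark on the poles. -/
def UDerivAtZero (a : ℂ) : ℂ :=
  -(Real.sqrt Real.pi : ℂ) / ((2 : ℂ) ^ (a / 2 - 1 / 4) * Complex.Gamma (1 / 4 + a / 2))

/-- The parabolic cylinder function `U(a,z)`, an entire function of `z` (and of `a`). -/
def U (a z : ℂ) : ℂ :=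
  UAtZero a * u₁ a z + UDerivAtZero a * u₂ a z

/-- The first `n` terms of the large-argument Poincaré expansion of `U(a,z)`, without its
prefactor: `∑_{s<n} (-1)^s (a+1/2)_{2s} / (s! (2z²)^s)`. -/
def poincareSum (n : ℕ) (a z : ℂ) : ℂ :=
  ∑ s ∈ Finset.range n,
    (-1) ^ s * (ascPochhammer ℂ (2 * s)).eval (a + 1 / 2) /
      ((Nat.factorial s : ℂ) * (2 * z ^ 2) ^ s)

/-- The remainder `R_n(a,z)`, determined for `z ≠ 0` by
`U(a,z) = z^{-a-1/2} e^{-z²/4} (poincareSum n a z + R_n(a,z))`, with the principal power. -/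
def R (n : ℕ) (a z : ℂ) : ℂ :=
  U a z / (z ^ (-a - 1 / 2) * Complex.exp (-z ^ 2 / 4)) - poincareSum n a z

end ParabolicCylinder

end

noncomputable section

namespace ParabolicCylinder

open Filter Topology MeasureTheory Set

/-! ### Power series whose coefficients obey a two-step recurrence -/

/-! Put c = a+1/2 and W = z^c e^{z²/4} U. Then W satisfies W'' - (z + 2c/z) W' + c(c+1) z^{-2} W =
0, that is, (W' e)' = -c(c+1) z^{-2} W e with the weight e = z^{-2c} e^{-z²/2}. The partial sums of
the expansion satisfy this up to a single power of z, so the remainder obeys the same equation with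
an explicit one-term forcing (`hasDerivAt_R_deriv_mul_weight`).

The equation is integrated twice from infinity along the horizontal ray z+τ, τ ≥ 0. There Im is
constant and |z+τ| increases, so |e| decreases if c ≥ 0, and otherwise grows at most like a power
(`norm_weight_add_le`). Since |z+τ|² ≥ |z|²+τ², both integrations are elementary
(`norm_le_of_second_order`). With M the supremum of the suitably weighted remainder over a sector,
this gives M ≤ (A + κM)/(2k), where κ = |c(c+1)|. If M is finite and κ < 2k, then M ≤ A/(2k-κ). The
aperture of the sector does not enter this bound (`norm_R_le`).

That M is finite, and that the boundary terms at infinity vanish, follows from the Laplace integral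
of e^{-t²/2} t^{c-1} when c > 0, and for the other real a from a three-term recurrence in a
(`sectorBounded`).

For order 35 the condition κ < 2k fails near a = 10, so R_35 is written as the terms 35 to 69 plus
R_70. Every term is largest in modulus at a = 10, |z| = 12, and a finite computation with rationals
finishes. The imaginary axis is reached by continuity. -/

theorem summable_of_two_step {f l : ℕ → ℝ} (hf : ∀ k, 0 ≤ f k)
    (hl : Tendsto l atTop (𝓝 0)) (h : ∀ k, f (k + 2) = l k * f k) : Summable f := by
  have key : ∀ i : ℕ, Summable fun k => f (2 * k + i) := by
    intro i
    refine summable_of_ratio_norm_eventually_le (r := 1 / 2) (by norm_num) ?_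
    have ht : Tendsto (fun k : ℕ => 2 * k + i) atTop atTop :=
      tendsto_atTop_mono (fun k => by simp only [id]; omega) tendsto_id
    filter_upwards [(hl.comp ht).eventually (gt_mem_nhds (show (0 : ℝ) < 1 / 2 by norm_num))]
      with k hk
    rw [Real.norm_of_nonneg (hf _), Real.norm_of_nonneg (hf _),
      show 2 * (k + 1) + i = 2 * k + i + 2 by ring, h]
    exact mul_le_mul_of_nonneg_right (le_of_lt hk) (hf _)
  exact Summable.even_add_odd (by simpa using key 0) (key 1)

theorem summable_norm_mul_pow_div_factorial {g : ℕ → ℂ} {c : ℂ}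
    (hg : ∀ k : ℕ, g (k + 2) = (c + k) * g k) (r : ℝ) (hr : 0 ≤ r) :
    Summable fun k : ℕ => ‖g k‖ * r ^ k / (k.factorial : ℝ) := by
  refine summable_of_two_step (l := fun k => ‖c + k‖ * r ^ 2 / ((k + 1) * (k + 2)))
    (fun k => by positivity) ?_ ?_
  · have h1 : Tendsto (fun k : ℕ => (‖c‖ + 1) * r ^ 2 / ((k : ℝ) + 1)) atTop (𝓝 0) := by
      have := (tendsto_one_div_add_atTop_nhds_zero_nat (𝕜 := ℝ)).const_mul ((‖c‖ + 1) * r ^ 2)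
      simpa [div_eq_mul_inv] using this
    refine squeeze_zero (fun k => by positivity) (fun k => ?_) h1
    rw [div_le_div_iff₀ (by positivity) (by positivity)]
    have h2 : ‖c + k‖ ≤ (‖c‖ + 1) * (k + 2) := by
      calc ‖c + k‖ ≤ ‖c‖ + k := by simpa using norm_add_le c (k : ℂ)
        _ ≤ _ := by nlinarith [norm_nonneg c, (Nat.cast_nonneg k : (0 : ℝ) ≤ k)]
    calc ‖c + k‖ * r ^ 2 * (k + 1) ≤ (‖c‖ + 1) * (k + 2) * r ^ 2 * (k + 1) := by gcongr
      _ = _ := by ring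
  · intro k
    rw [hg, norm_mul, Nat.factorial_succ, Nat.factorial_succ]
    push_cast
    have : (k.factorial : ℝ) ≠ 0 := by positivity
    field_simp
    ring

theorem summable_mul_pow_div_factorial {g : ℕ → ℂ}
    (hg : ∀ r : ℝ, 0 ≤ r → Summable fun k : ℕ => ‖g k‖ * r ^ k / (k.factorial : ℝ)) (z : ℂ) :
    Summable fun k : ℕ => g k * z ^ k / (k.factorial : ℂ) :=
  Summable.of_norm (by simpa using hg ‖z‖ (norm_nonneg z))

theorem hasDerivAt_tsum_mul_pow_div_factorial {g : ℕ → ℂ}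
    (hg : ∀ r : ℝ, 0 ≤ r → Summable fun k : ℕ => ‖g k‖ * r ^ k / (k.factorial : ℝ))
    (hg' : ∀ r : ℝ, 0 ≤ r → Summable fun k : ℕ => ‖g (k + 1)‖ * r ^ k / (k.factorial : ℝ))
    (z : ℂ) :
    HasDerivAt (fun z => ∑' k : ℕ, g k * z ^ k / (k.factorial : ℂ))
      (∑' k : ℕ, g (k + 1) * z ^ k / (k.factorial : ℂ)) z := by
  set ρ : ℝ := ‖z‖ + 1 with hρ
  have hρ0 : 0 ≤ ρ := by positivity
  have hterm : ∀ (k : ℕ) (y : ℂ), g (k + 1) * (((k + 1 : ℕ) : ℂ) * y ^ k) /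
      ((k + 1).factorial : ℂ) = g (k + 1) * y ^ k / (k.factorial : ℂ) := by
    intro k y
    rw [Nat.factorial_succ]
    have h1 : (k.factorial : ℂ) ≠ 0 := by exact_mod_cast k.factorial_ne_zero
    have h2 : ((k : ℂ) + 1) ≠ 0 := by exact_mod_cast k.succ_ne_zero
    push_cast
    field_simp
  have hs : Summable fun k : ℕ => ‖g k‖ * (k * ρ ^ (k - 1)) / (k.factorial : ℝ) := by
    rw [← summable_nat_add_iff 1]
    refine (hg' ρ hρ0).congr fun k => ?_
    rw [Nat.factorial_succ]
    have h1 : (k.factorial : ℝ) ≠ 0 := by positivity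
    push_cast
    field_simp
  have hz : z ∈ Metric.ball (0 : ℂ) ρ := by simp [hρ]
  have hd := hasDerivAt_tsum_of_isPreconnected (𝕜 := ℂ) hs Metric.isOpen_ball
    (convex_ball (0 : ℂ) ρ).isPreconnected
    (g := fun k z => g k * z ^ k / (k.factorial : ℂ))
    (g' := fun k z => g k * (k * z ^ (k - 1)) / (k.factorial : ℂ))
    (fun k y _ => (((hasDerivAt_pow k y).const_mul (g k)).div_const _))
    (fun k y hy => by
      have hy' : ‖y‖ ≤ ρ := by simpa using (mem_ball_zero_iff.1 hy).le
      simp only [norm_div, norm_mul, norm_pow, Complex.norm_natCast]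
      gcongr) hz (summable_mul_pow_div_factorial hg z) hz
  refine hd.congr_deriv ?_
  have hs' : Summable fun k : ℕ => g k * (k * z ^ (k - 1)) / (k.factorial : ℂ) := by
    rw [← summable_nat_add_iff 1]
    exact (summable_mul_pow_div_factorial hg' z).congr fun k => (hterm k z).symm
  rw [hs'.tsum_eq_zero_add]
  simp only [Nat.cast_zero, zero_mul, mul_zero, zero_div, zero_add]
  exact tsum_congr fun k => hterm k z

/-! ### The function `V = e^{z²/4} U` -/

/-- The derivatives at `0` of `e^{z²/4} U(a,z)`. -/
def coef (a : ℂ) : ℕ → ℂ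
  | 0 => UAtZero a
  | 1 => UDerivAtZero a
  | (k + 2) => (a + 1 / 2 + k) * coef a k

/-- `V(a,z) = e^{z²/4} U(a,z)`, as a power series. -/
def V (a z : ℂ) : ℂ := ∑' k : ℕ, coef a k * z ^ k / (k.factorial : ℂ)

/-- This encodes V'' = z V' + (a+1/2) V, the equation for U after removing e^{-z²/4}. -/
theorem coef_add_two (a : ℂ) (k : ℕ) : coef a (k + 2) = (a + 1 / 2 + k) * coef a k := by
  rw [coef]

theorem summable_norm_coef (a : ℂ) (r : ℝ) (hr : 0 ≤ r) :
    Summable fun k : ℕ => ‖coef a k‖ * r ^ k / (k.factorial : ℝ) :=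
  summable_norm_mul_pow_div_factorial (coef_add_two a) r hr

theorem summable_norm_coef_succ (a : ℂ) (r : ℝ) (hr : 0 ≤ r) :
    Summable fun k : ℕ => ‖coef a (k + 1)‖ * r ^ k / (k.factorial : ℝ) :=
  summable_norm_mul_pow_div_factorial (c := a + 3 / 2) (g := fun k => coef a (k + 1))
    (fun k => by
      rw [show k + 2 + 1 = k + 1 + 2 by ring, coef_add_two]
      push_cast
      ring) r hr

theorem summable_coef (a z : ℂ) : Summable fun k : ℕ => coef a k * z ^ k / (k.factorial : ℂ) :=
  summable_mul_pow_div_factorial (summable_norm_coef a) z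

theorem coef_even (a : ℂ) (k : ℕ) :
    coef a (2 * k) = UAtZero a * ∏ j ∈ Finset.range k, (a + 1 / 2 + 2 * (j : ℂ)) := by
  induction k with
  | zero => simp [coef]
  | succ k ih =>
    rw [show 2 * (k + 1) = 2 * k + 2 by ring, coef_add_two, ih, Finset.prod_range_succ]
    push_cast
    ring

theorem coef_odd (a : ℂ) (k : ℕ) :
    coef a (2 * k + 1) = UDerivAtZero a * ∏ j ∈ Finset.range k, (a + 3 / 2 + 2 * (j : ℂ)) := by
  induction k with
  | zero => simp [coef]
  | succ k ih =>
    rw [show 2 * (k + 1) + 1 = 2 * k + 1 + 2 by ring, coef_add_two, ih, Finset.prod_range_succ]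
    push_cast
    ring

theorem U_eq_exp_mul_V (a z : ℂ) : U a z = Complex.exp (-z ^ 2 / 4) * V a z := by
  have he : HasSum (fun k : ℕ => coef a (2 * k) * z ^ (2 * k) / ((2 * k).factorial : ℂ))
      (∑' k : ℕ, coef a (2 * k) * z ^ (2 * k) / ((2 * k).factorial : ℂ)) :=
    ((summable_coef a z).comp_injective (mul_right_injective₀ (two_ne_zero' ℕ))).hasSum
  have ho : HasSum
      (fun k : ℕ => coef a (2 * k + 1) * z ^ (2 * k + 1) / ((2 * k + 1).factorial : ℂ))
      (∑' k : ℕ, coef a (2 * k + 1) * z ^ (2 * k + 1) / ((2 * k + 1).factorial : ℂ)) :=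
    ((summable_coef a z).comp_injective
      ((add_left_injective 1).comp (mul_right_injective₀ (two_ne_zero' ℕ)))).hasSum
  have hV : V a z = _ := (HasSum.even_add_odd (f := fun k : ℕ =>
    coef a k * z ^ k / (k.factorial : ℂ)) he ho).tsum_eq
  rw [U, u₁, u₂, hV, mul_add, mul_left_comm, mul_left_comm (UDerivAtZero a),
    ← tsum_mul_left (a := UAtZero a), ← tsum_mul_left (a := UDerivAtZero a)]
  congr 2
  · refine tsum_congr fun k => ?_
    rw [coef_even]
    ring
  · refine tsum_congr fun k => ?_
    rw [coef_odd]
    ring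

theorem UDerivAtZero_add_one (a : ℂ) : UDerivAtZero (a + 1) = -UAtZero a := by
  rw [UDerivAtZero, UAtZero, neg_div]
  congr 4 <;> ring_nf

/-- The functional equation of 1/Γ is used rather than that of Γ, so poles need no separate
treatment. -/
theorem UDerivAtZero_eq (a : ℂ) : UDerivAtZero a = -((a + 1 / 2) * UAtZero (a + 1)) := by
  have h := Complex.one_div_Gamma_eq_self_mul_one_div_Gamma_add_one (1 / 4 + a / 2)
  have h2 : (2 : ℂ) ^ ((a + 1) / 2 + 1 / 4) = 2 ^ (a / 2 - 1 / 4) * 2 := by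
    rw [show (a + 1) / 2 + 1 / 4 = (a / 2 - 1 / 4) + 1 by ring,
      Complex.cpow_add _ _ two_ne_zero, Complex.cpow_one]
  rw [UDerivAtZero, UAtZero, h2, show 3 / 4 + (a + 1) / 2 = 1 / 4 + a / 2 + 1 by ring]
  simp only [div_eq_mul_inv, mul_inv] at h ⊢
  rw [h]
  ring

theorem coef_succ (a : ℂ) (k : ℕ) : coef a (k + 1) = -((a + 1 / 2) * coef (a + 1) k) := by
  induction k using Nat.twoStepInduction with
  | zero => simpa [coef] using UDerivAtZero_eq a
  | one =>
    rw [coef_add_two]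
    simp only [coef, UDerivAtZero_add_one, Nat.cast_zero]
    ring
  | more k ih _ =>
    rw [show k + 2 + 1 = k + 1 + 2 by ring, coef_add_two, coef_add_two, ih]
    push_cast
    ring

theorem hasDerivAt_V (a z : ℂ) : HasDerivAt (V a) (-((a + 1 / 2) * V (a + 1) z)) z := by
  refine (hasDerivAt_tsum_mul_pow_div_factorial (summable_norm_coef a)
    (summable_norm_coef_succ a) z).congr_deriv ?_
  rw [V, ← tsum_mul_left, ← tsum_neg]
  refine tsum_congr fun k => ?_
  rw [coef_succ]
  ring

theorem coef_recurrence (a : ℂ) (k : ℕ) :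
    coef a (k + 1) = (k + 1) * coef (a + 1) k + (a + 3 / 2) * coef (a + 2) (k + 1) := by
  have h1 := coef_succ (a + 1) (k + 1)
  have h2 := coef_add_two (a + 1) k
  have h3 := coef_succ a k
  rw [show k + 1 + 1 = k + 2 by ring, h2, show a + 1 + 1 = a + 2 by ring] at h1
  rw [h3]
  linear_combination -h1

/-- The classical three-term recurrence in the parameter, checked on Taylor coefficients. It permits
downward steps in a, past the range of the integral representation. -/
theorem V_recurrence (a z : ℂ) :
    V a z = z * V (a + 1) z + (a + 3 / 2) * V (a + 2) z := by
  have h0 : coef a 0 = (a + 3 / 2) * coef (a + 2) 0 := by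
    have h1 := UDerivAtZero_eq (a + 1)
    rw [UDerivAtZero_add_one, show a + 1 + 1 = a + 2 by ring] at h1
    simp only [coef]
    linear_combination -h1
  rw [V, V, V, (summable_coef a z).tsum_eq_zero_add, (summable_coef (a + 2) z).tsum_eq_zero_add,
    mul_add, ← tsum_mul_left, ← tsum_mul_left, add_left_comm,
    ← (Summable.mul_left z (summable_coef (a + 1) z)).tsum_add
      (Summable.mul_left _ ((summable_nat_add_iff 1).2 (summable_coef (a + 2) z)))]
  congr 1
  · rw [h0]
    ring
  · refine tsum_congr fun k => ?_
    rw [coef_recurrence, Nat.factorial_succ]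
    have h1 : (k.factorial : ℂ) ≠ 0 := by exact_mod_cast k.factorial_ne_zero
    have h2 : ((k : ℂ) + 1) ≠ 0 := by exact_mod_cast k.succ_ne_zero
    push_cast
    field_simp
    ring

/-! ### Laplace transform of a power -/

theorem integrableOn_rpow_mul_exp_neg_mul {s x : ℝ} (hs : 0 < s) (hx : 0 < x) :
    IntegrableOn (fun t : ℝ => t ^ (s - 1) * Real.exp (-x * t)) (Ioi 0) := by
  simpa using integrableOn_rpow_mul_exp_neg_mul_rpow (s := s - 1) (by linarith) one_pos hx

theorem norm_cexp_neg_mul_ofReal (z : ℂ) (t : ℝ) :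
    ‖Complex.exp (-z * t)‖ = Real.exp (-z.re * t) := by
  rw [Complex.norm_exp]
  simp

theorem aestronglyMeasurable_rpow_mul_cexp (s : ℝ) (z : ℂ) :
    AEStronglyMeasurable (fun t : ℝ => ((t ^ s : ℝ) : ℂ) * Complex.exp (-z * t))
      (volume.restrict (Ioi 0)) := by
  apply Measurable.aestronglyMeasurable
  fun_prop

theorem integrableOn_rpow_mul_cexp_neg_mul {s : ℝ} {z : ℂ} (hs : 0 < s) (hz : 0 < z.re) :
    IntegrableOn (fun t : ℝ => ((t ^ (s - 1) : ℝ) : ℂ) * Complex.exp (-z * t)) (Ioi 0) := by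
  refine (integrableOn_rpow_mul_exp_neg_mul hs hz).mono'
    (aestronglyMeasurable_rpow_mul_cexp _ _) ?_
  filter_upwards [ae_restrict_mem measurableSet_Ioi] with t ht
  rw [norm_mul, norm_cexp_neg_mul_ofReal, Complex.norm_real,
    Real.norm_of_nonneg (Real.rpow_nonneg (le_of_lt ht) _)]

theorem differentiableAt_integral_rpow_mul_cexp_neg_mul {s : ℝ} {z : ℂ} (hs : 0 < s)
    (hz : 0 < z.re) :
    DifferentiableAt ℂ
      (fun w : ℂ => ∫ t : ℝ in Ioi 0, ((t ^ (s - 1) : ℝ) : ℂ) * Complex.exp (-w * t)) z := by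
  -- Near z the real part stays above Re z / 2, which supplies a dominating function independent of
  -- w.
  have hx : 0 < z.re / 2 := by linarith
  have hU : {w : ℂ | z.re / 2 < w.re} ∈ 𝓝 z :=
    (isOpen_lt continuous_const Complex.continuous_re).mem_nhds (by simp; linarith)
  refine (hasDerivAt_integral_of_dominated_loc_of_deriv_le
    (F := fun (w : ℂ) (t : ℝ) => ((t ^ (s - 1) : ℝ) : ℂ) * Complex.exp (-w * t))
    (F' := fun (w : ℂ) (t : ℝ) => ((t ^ (s - 1) : ℝ) : ℂ) * (Complex.exp (-w * t) * (-t)))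
    (bound := fun t : ℝ => t ^ (s + 1 - 1) * Real.exp (-(z.re / 2) * t))
    hU (Eventually.of_forall fun w => aestronglyMeasurable_rpow_mul_cexp _ _)
    (integrableOn_rpow_mul_cexp_neg_mul hs hz) ?_ ?_
    (integrableOn_rpow_mul_exp_neg_mul (by linarith) hx) ?_).2.differentiableAt
  · apply Measurable.aestronglyMeasurable
    fun_prop
  · filter_upwards [ae_restrict_mem measurableSet_Ioi] with t ht w hw
    have ht' : (0 : ℝ) < t := ht
    have hw' : z.re / 2 < w.re := hw
    rw [norm_mul, norm_mul, norm_cexp_neg_mul_ofReal, Complex.norm_real, norm_neg,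
      Complex.norm_real, Real.norm_of_nonneg (Real.rpow_nonneg ht'.le _),
      Real.norm_of_nonneg ht'.le, show s + 1 - 1 = (s - 1) + 1 by ring,
      Real.rpow_add_one ht'.ne', mul_comm (Real.exp _), ← mul_assoc]
    gcongr
  · refine Eventually.of_forall fun t w _ => ?_
    have h := (((hasDerivAt_id w).neg.mul_const (t : ℂ)).cexp).const_mul ((t ^ (s - 1) : ℝ) : ℂ)
    simpa using h

/-- Both sides are analytic in the right half-plane and agree on the positive reals, which
accumulate at 1. -/
theorem integral_rpow_mul_cexp_neg_mul {s : ℝ} {z : ℂ} (hs : 0 < s) (hz : 0 < z.re) :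
    ∫ t : ℝ in Ioi 0, ((t ^ (s - 1) : ℝ) : ℂ) * Complex.exp (-z * t) =
      Real.Gamma s * z ^ (-s : ℂ) := by
  have hopen : IsOpen {w : ℂ | 0 < w.re} := isOpen_lt continuous_const Complex.continuous_re
  have hconv : Convex ℝ {w : ℂ | 0 < w.re} := convex_halfSpace_re_gt 0
  have hf : AnalyticOnNhd ℂ
      (fun w : ℂ => ∫ t : ℝ in Ioi 0, ((t ^ (s - 1) : ℝ) : ℂ) * Complex.exp (-w * t))
      {w : ℂ | 0 < w.re} :=
    DifferentiableOn.analyticOnNhd (fun w hw =>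
      (differentiableAt_integral_rpow_mul_cexp_neg_mul hs hw).differentiableWithinAt) hopen
  have hg : AnalyticOnNhd ℂ (fun w : ℂ => Real.Gamma s * w ^ (-s : ℂ)) {w : ℂ | 0 < w.re} :=
    DifferentiableOn.analyticOnNhd (fun w hw =>
      ((differentiableAt_id.cpow_const (Or.inl hw)).const_mul _).differentiableWithinAt) hopen
  refine hf.eqOn_of_preconnected_of_frequently_eq hg hconv.isPreconnected
    (show (1 : ℂ) ∈ {w : ℂ | 0 < w.re} by simp) ?_ hz
  have hreal : ∀ r : ℝ, 0 < r →
      ∫ t : ℝ in Ioi 0, ((t ^ (s - 1) : ℝ) : ℂ) * Complex.exp (-(r : ℂ) * t) =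
        Real.Gamma s * (r : ℂ) ^ (-s : ℂ) := by
    intro r hr
    have h := Real.integral_rpow_mul_exp_neg_mul_Ioi hs hr
    rw [one_div, Real.inv_rpow hr.le, ← Real.rpow_neg hr.le] at h
    rw [← Complex.ofReal_neg s, ← Complex.ofReal_cpow hr.le, ← Complex.ofReal_mul, mul_comm, ← h,
      ← integral_complex_ofReal]
    simp
  have ht : Tendsto (fun n : ℕ => (((1 + 1 / ((n : ℝ) + 1) : ℝ)) : ℂ)) atTop (𝓝[≠] 1) := by
    refine tendsto_nhdsWithin_iff.2 ⟨?_, Eventually.of_forall fun n => ?_⟩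
    · have := (tendsto_one_div_add_atTop_nhds_zero_nat (𝕜 := ℝ)).const_add 1
      rw [add_zero] at this
      exact (Complex.continuous_ofReal.tendsto 1).comp this
    · have : (0 : ℝ) < 1 / ((n : ℝ) + 1) := by positivity
      rw [mem_compl_singleton_iff, Ne, Complex.ofReal_eq_one]
      linarith
  exact ht.frequently (Frequently.of_forall fun n => hreal _ (by positivity))

/-! ### The integral representation of `V` -/

/-- The moments of the half-Gaussian `e^{-t²/2}`. -/
theorem integral_rpow_mul_exp_neg_sq_half {q : ℝ} (hq : 0 < q) :
    ∫ t : ℝ in Ioi 0, t ^ (q - 1) * Real.exp (-(1 / 2) * t ^ 2) =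
      2 ^ (q / 2 - 1) * Real.Gamma (q / 2) := by
  have h := integral_rpow_mul_exp_neg_mul_rpow (p := 2) (q := q - 1) (b := 1 / 2) two_pos
    (by linarith) (by norm_num)
  simp only [Real.rpow_two] at h
  rw [h, show q - 1 + 1 = q by ring, one_div, Real.inv_rpow zero_le_two,
    show -q / 2 = -(q / 2) by ring, Real.rpow_neg zero_le_two, inv_inv,
    Real.rpow_sub_one two_ne_zero]
  ring

/-- The right side is (-1)^k times a half-Gaussian moment, that is, the k-th derivative at 0 of the
Laplace integral. The cases k = 0, 1 are the duplication formula; both sides obey the same two-step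
recurrence. -/
theorem Gamma_mul_coef {a : ℝ} (ha : -(1 / 2) < a) (k : ℕ) :
    (Real.Gamma (a + 1 / 2) : ℂ) * coef a k =
      (-1) ^ k * ((2 ^ ((a + 1 / 2 + k) / 2 - 1) * Real.Gamma ((a + 1 / 2 + k) / 2) : ℝ) : ℂ) := by
  have hdup := Real.Gamma_mul_Gamma_add_half (a / 2 + 1 / 4)
  rw [show 2 * (a / 2 + 1 / 4) = a + 1 / 2 by ring,
    show a / 2 + 1 / 4 + 1 / 2 = 3 / 4 + a / 2 by ring] at hdup
  have hp1 : 0 < Real.Gamma (a / 2 + 1 / 4) := Real.Gamma_pos_of_pos (by linarith)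
  have hp2 : 0 < Real.Gamma (3 / 4 + a / 2) := Real.Gamma_pos_of_pos (by linarith)
  have h2 : (0 : ℝ) < 2 ^ (a / 2 + 1 / 4) := Real.rpow_pos_of_pos two_pos _
  have e1 : (2 : ℝ) ^ (1 - (a + 1 / 2)) = 2 / (2 ^ (a / 2 + 1 / 4) * 2 ^ (a / 2 + 1 / 4)) := by
    rw [← Real.rpow_add two_pos, Real.rpow_sub two_pos, Real.rpow_one]
    congr 2
    ring
  rw [e1] at hdup
  induction k using Nat.twoStepInduction with
  | zero =>
    have hU : UAtZero a =
        ((√Real.pi / (2 ^ (a / 2 + 1 / 4) * Real.Gamma (3 / 4 + a / 2)) : ℝ) : ℂ) := by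
      rw [UAtZero]
      push_cast [Complex.ofReal_cpow zero_le_two, ← Complex.Gamma_ofReal]
      rfl
    rw [coef, hU, pow_zero, one_mul, ← Complex.ofReal_mul, Complex.ofReal_inj,
      Nat.cast_zero, add_zero, show (a + 1 / 2) / 2 = a / 2 + 1 / 4 by ring,
      Real.rpow_sub_one two_ne_zero]
    generalize Real.Gamma (a / 2 + 1 / 4) = G₁ at *
    generalize Real.Gamma (3 / 4 + a / 2) = G₂ at *
    generalize Real.Gamma (a + 1 / 2) = G at *
    generalize (2 : ℝ) ^ (a / 2 + 1 / 4) = p at *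
    field_simp at hdup ⊢
    linear_combination -hdup
  | one =>
    have hU : UDerivAtZero a =
        ((-√Real.pi / (2 ^ (a / 2 - 1 / 4) * Real.Gamma (a / 2 + 1 / 4)) : ℝ) : ℂ) := by
      rw [UDerivAtZero, add_comm (1 / 4 : ℂ)]
      push_cast [Complex.ofReal_cpow zero_le_two, ← Complex.Gamma_ofReal]
      rfl
    have e2 : (2 : ℝ) ^ (a / 2 + 1 / 4) = 2 ^ (a / 2 - 1 / 4) * 2 ^ (1 / 2 : ℝ) := by
      rw [← Real.rpow_add two_pos]
      congr 1
      ring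
    have e3 : (2 : ℝ) ^ (1 / 2 : ℝ) * 2 ^ (1 / 2 : ℝ) = 2 := by
      rw [← Real.rpow_add two_pos]
      norm_num
    have h3 : (0 : ℝ) < 2 ^ (a / 2 - 1 / 4) := Real.rpow_pos_of_pos two_pos _
    have e4 : 2 ^ (a / 2 + 1 / 4) * (2 : ℝ) ^ (a / 2 + 1 / 4) =
        2 ^ (a / 2 - 1 / 4) * 2 ^ (a / 2 - 1 / 4) * 2 := by
      rw [e2]
      linear_combination (2 ^ (a / 2 - 1 / 4) * (2 : ℝ) ^ (a / 2 - 1 / 4)) * e3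
    rw [e4] at hdup
    rw [coef, hU, pow_one, ← Complex.ofReal_mul, neg_one_mul, ← Complex.ofReal_neg,
      Complex.ofReal_inj, Nat.cast_one,
      show (a + 1 / 2 + 1) / 2 - 1 = a / 2 - 1 / 4 by ring,
      show (a + 1 / 2 + 1) / 2 = 3 / 4 + a / 2 by ring]
    generalize Real.Gamma (a / 2 + 1 / 4) = G₁ at *
    generalize Real.Gamma (3 / 4 + a / 2) = G₂ at *
    generalize Real.Gamma (a + 1 / 2) = G at *
    generalize (2 : ℝ) ^ (a / 2 - 1 / 4) = p at *
    field_simp at hdup ⊢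
    linear_combination hdup
  | more k ih _ =>
    have hk : (0 : ℝ) < (a + 1 / 2 + k) / 2 := by
      have : (0 : ℝ) ≤ k := Nat.cast_nonneg k
      linarith
    rw [coef_add_two, mul_left_comm, ih, show (a + 1 / 2 + ((k + 2 : ℕ) : ℝ)) / 2 =
      (a + 1 / 2 + k) / 2 + 1 by push_cast; ring, Real.Gamma_add_one hk.ne', add_sub_right_comm,
      Real.rpow_add_one two_ne_zero, pow_add]
    push_cast
    ring

theorem Gamma_mul_V {a : ℝ} (ha : -(1 / 2) < a) (z : ℂ) :
    (Real.Gamma (a + 1 / 2) : ℂ) * V a z =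
      ∫ t : ℝ in Ioi 0, ((t ^ (a + 1 / 2 - 1) * Real.exp (-(1 / 2) * t ^ 2) : ℝ) : ℂ) *
        Complex.exp (-z * t) := by
  have hint : ∀ k : ℕ, IntegrableOn
      (fun t : ℝ => t ^ (a + 1 / 2 + k - 1) * Real.exp (-(1 / 2) * t ^ 2)) (Ioi 0) := fun k =>
    integrableOn_rpow_mul_exp_neg_mul_sq (by norm_num)
      (by have : (0 : ℝ) ≤ k := Nat.cast_nonneg k; linarith)
  have hpos : ∀ k : ℕ, 0 < a + 1 / 2 + k := fun k => by
    have : (0 : ℝ) ≤ k := Nat.cast_nonneg k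
    linarith
  let F : ℕ → ℝ → ℂ := fun k t =>
    ((t ^ (a + 1 / 2 + k - 1) * Real.exp (-(1 / 2) * t ^ 2) : ℝ) : ℂ) *
      ((-z) ^ k / (k.factorial : ℂ))
  have hFint : ∀ k, Integrable (F k) (volume.restrict (Ioi 0)) := fun k =>
    (hint k).ofReal.mul_const _
  have hFi : ∀ k, ∫ t in Ioi 0, F k t =
      Real.Gamma (a + 1 / 2) * (coef a k * z ^ k / (k.factorial : ℂ)) := by
    intro k
    simp only [F]
    rw [integral_mul_const, integral_complex_ofReal, integral_rpow_mul_exp_neg_sq_half (hpos k),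
      neg_pow]
    have h := Gamma_mul_coef ha k
    linear_combination (-(z ^ k / (k.factorial : ℂ))) * h
  have hFn : ∀ k, ∫ t in Ioi 0, ‖F k t‖ =
      Real.Gamma (a + 1 / 2) * (‖coef a k‖ * ‖z‖ ^ k / (k.factorial : ℝ)) := by
    intro k
    have h1 : ∫ t in Ioi 0, ‖F k t‖ =
        ∫ t in Ioi 0, (t ^ (a + 1 / 2 + k - 1) * Real.exp (-(1 / 2) * t ^ 2)) *
          (‖z‖ ^ k / (k.factorial : ℝ)) := by
      refine setIntegral_congr_fun measurableSet_Ioi fun t ht => ?_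
      have ht' : (0 : ℝ) < t := ht
      simp only [F]
      rw [norm_mul, Complex.norm_real, Real.norm_of_nonneg (by positivity)]
      simp
    have h2 := congrArg norm (Gamma_mul_coef ha k)
    have hG : 0 < Real.Gamma (a + 1 / 2) := Real.Gamma_pos_of_pos (by linarith)
    have hG' : 0 < Real.Gamma ((a + 1 / 2 + k) / 2) :=
      Real.Gamma_pos_of_pos (by linarith [hpos k])
    rw [norm_mul, norm_mul, norm_pow, norm_neg, norm_one, one_pow, one_mul, Complex.norm_real,
      Complex.norm_real, Real.norm_of_nonneg hG.le, Real.norm_of_nonneg (by positivity)] at h2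
    rw [h1, integral_mul_const, integral_rpow_mul_exp_neg_sq_half (hpos k), ← h2]
    ring
  -- The integrals of the norms are, up to Γ(a+1/2), the terms of the absolutely convergent series
  -- of V, so sum and integral may be exchanged.
  have hs := hasSum_integral_of_summable_integral_norm hFint (by
    simp_rw [hFn]
    exact (summable_norm_coef a ‖z‖ (norm_nonneg z)).mul_left _)
  simp_rw [hFi] at hs
  rw [V, ← tsum_mul_left, hs.tsum_eq]
  refine setIntegral_congr_fun measurableSet_Ioi fun t ht => ?_
  have ht' : (0 : ℝ) < t := ht
  have hexp : HasSum (fun k : ℕ => (-z * t) ^ k / (k.factorial : ℂ)) (Complex.exp (-z * t)) := by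
    rw [Complex.exp_eq_exp_ℂ]
    exact NormedSpace.expSeries_div_hasSum_exp (-z * t)
  refine HasSum.tsum_eq ((hexp.mul_left _).congr_fun fun k => ?_)
  simp only [F]
  rw [show a + 1 / 2 + (k : ℝ) - 1 = a + 1 / 2 - 1 + k by ring, Real.rpow_add_natCast ht'.ne',
    mul_pow]
  push_cast
  ring

/-! ### Recurrences for the remainder -/

/-- The coefficient of `z^{-2s}` in the Poincaré expansion. -/
def pcoef (s : ℕ) (a : ℂ) : ℂ :=
  (-1) ^ s * (ascPochhammer ℂ (2 * s)).eval (a + 1 / 2) / ((s.factorial : ℂ) * 2 ^ s)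

/-- `W(a,z) = z^{a+1/2} e^{z²/4} U(a,z)`. -/
def W (a z : ℂ) : ℂ := z ^ (a + 1 / 2) * V a z

theorem poincareSum_eq (n : ℕ) (a z : ℂ) :
    poincareSum n a z = ∑ s ∈ Finset.range n, pcoef s a / z ^ (2 * s) := by
  refine Finset.sum_congr rfl fun s _ => ?_
  rw [pcoef, div_div, mul_pow, pow_mul, mul_assoc]

theorem R_eq_W_sub (n : ℕ) (a z : ℂ) :
    R n a z = W a z - poincareSum n a z := by
  rw [R, U_eq_exp_mul_V, W, mul_comm (z ^ _), mul_div_mul_left _ _ (Complex.exp_ne_zero _),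
    show -a - 1 / 2 = -(a + 1 / 2) by ring, Complex.cpow_neg, div_inv_eq_mul, mul_comm (V a z)]

theorem R_zero (a z : ℂ) : R 0 a z = W a z := by
  rw [R_eq_W_sub, poincareSum, Finset.sum_range_zero, sub_zero]

theorem R_succ (n : ℕ) (a z : ℂ) : R (n + 1) a z = R n a z - pcoef n a / z ^ (2 * n) := by
  rw [R, R, poincareSum_eq, poincareSum_eq, Finset.sum_range_succ]
  ring

theorem ascPochhammer_eval_add_two (n : ℕ) (c : ℂ) :
    (ascPochhammer ℂ (n + 2)).eval c = c * (c + 1) * (ascPochhammer ℂ n).eval (c + 2) := by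
  rw [ascPochhammer_succ_left, Polynomial.eval_mul, Polynomial.eval_comp, ascPochhammer_succ_left,
    Polynomial.eval_mul, Polynomial.eval_comp]
  simp only [Polynomial.eval_X, Polynomial.eval_add, Polynomial.eval_one]
  rw [show c + 1 + 1 = c + 2 by ring, mul_assoc]

theorem pcoef_succ (s : ℕ) (a : ℂ) :
    2 * (s + 1) * pcoef (s + 1) a = -((a + 1 / 2) * (a + 3 / 2) * pcoef s (a + 2)) := by
  have h := ascPochhammer_eval_add_two (2 * s) (a + 1 / 2)
  have h1 : (s.factorial : ℂ) ≠ 0 := by exact_mod_cast s.factorial_ne_zero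
  have h2 : ((s : ℂ) + 1) ≠ 0 := by exact_mod_cast s.succ_ne_zero
  rw [pcoef, pcoef, show 2 * (s + 1) = 2 * s + 2 by ring, h, Nat.factorial_succ,
    show a + 1 / 2 + 2 = a + 2 + 1 / 2 by ring]
  push_cast
  field_simp
  ring

theorem pcoef_recurrence (s : ℕ) (a : ℂ) :
    pcoef (s + 1) a = pcoef (s + 1) (a + 1) + (a + 3 / 2) * pcoef s (a + 2) := by
  have h := ascPochhammer_eval_add_two (2 * s) (a + 1 / 2)
  have h' : (ascPochhammer ℂ (2 * s + 2)).eval (a + 1 + 1 / 2) =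
      (a + 3 / 2) * (ascPochhammer ℂ (2 * s)).eval (a + 1 / 2 + 2) * (a + 5 / 2 + 2 * s) := by
    rw [show 2 * s + 2 = 2 * s + 1 + 1 by ring, ascPochhammer_succ_left, Polynomial.eval_mul,
      Polynomial.eval_comp]
    simp only [Polynomial.eval_X, Polynomial.eval_add, Polynomial.eval_one]
    rw [ascPochhammer_succ_eval, show a + 1 + 1 / 2 + 1 = a + 1 / 2 + 2 by ring]
    push_cast
    ring
  have h1 : (s.factorial : ℂ) ≠ 0 := by exact_mod_cast s.factorial_ne_zero
  have h2 : ((s : ℂ) + 1) ≠ 0 := by exact_mod_cast s.succ_ne_zero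
  rw [pcoef, pcoef, pcoef, show 2 * (s + 1) = 2 * s + 2 by ring, h, h', Nat.factorial_succ,
    show a + 2 + 1 / 2 = a + 1 / 2 + 2 by ring]
  push_cast
  field_simp
  ring

theorem W_recurrence (a : ℂ) {z : ℂ} (hz : z ≠ 0) :
    W a z = W (a + 1) z + (a + 3 / 2) / z ^ 2 * W (a + 2) z := by
  have e1 : z ^ (a + 1 + 1 / 2) = z ^ (a + 1 / 2) * z := by
    rw [show a + 1 + 1 / 2 = a + 1 / 2 + 1 by ring, Complex.cpow_add _ _ hz, Complex.cpow_one]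
  have e2 : z ^ (a + 2 + 1 / 2) = z ^ (a + 1 / 2) * z ^ 2 := by
    rw [show a + 2 + 1 / 2 = a + 1 / 2 + (2 : ℕ) by push_cast; ring, Complex.cpow_add _ _ hz,
      Complex.cpow_natCast]
  rw [W, W, W, e1, e2, V_recurrence a z]
  field_simp

theorem R_zero_recurrence (a : ℂ) {z : ℂ} (hz : z ≠ 0) :
    R 0 a z = R 0 (a + 1) z + (a + 3 / 2) / z ^ 2 * R 0 (a + 2) z := by
  rw [R_zero, R_zero, R_zero, W_recurrence a hz]

theorem R_recurrence (n : ℕ) (a : ℂ) {z : ℂ} (hz : z ≠ 0) :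
    R (n + 1) a z = R (n + 1) (a + 1) z + (a + 3 / 2) / z ^ 2 * R n (a + 2) z := by
  induction n with
  | zero =>
    rw [R_succ, R_succ, R_zero_recurrence a hz]
    simp [pcoef]
    ring
  | succ n ih =>
    rw [R_succ (n + 1), ih, R_succ (n + 1) (a + 1), R_succ n (a + 2), pcoef_recurrence]
    field_simp
    ring

theorem hasDerivAt_W (a : ℂ) {z : ℂ} (hz : z ∈ Complex.slitPlane) :
    HasDerivAt (W a) ((a + 1 / 2) * (a + 3 / 2) / z ^ 3 * W (a + 2) z) z := by
  have hz0 := Complex.slitPlane_ne_zero hz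
  refine (((hasDerivAt_id z).cpow_const (c := a + 1 / 2) hz).mul (hasDerivAt_V a z)).congr_deriv ?_
  have e0 : z ^ (a + 1 / 2) = z ^ (a + 1 / 2 - 1) * z := by
    rw [Complex.cpow_sub _ _ hz0, Complex.cpow_one, div_mul_cancel₀ _ hz0]
  have e2 : z ^ (a + 2 + 1 / 2) = z ^ (a + 1 / 2) * z ^ 2 := by
    rw [show a + 2 + 1 / 2 = a + 1 / 2 + (2 : ℕ) by push_cast; ring, Complex.cpow_add _ _ hz0,
      Complex.cpow_natCast]
  have hV := V_recurrence a z
  simp only [id, W, e2]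
  rw [e0, hV]
  field_simp
  ring

/-- Differentiation lowers the order by one and shifts a by two, both for W (through `V_recurrence`)
and term by term for the expansion (through `pcoef_succ`). -/
theorem hasDerivAt_R (n : ℕ) (a : ℂ) {z : ℂ} (hz : z ∈ Complex.slitPlane) :
    HasDerivAt (R (n + 1) a) ((a + 1 / 2) * (a + 3 / 2) / z ^ 3 * R n (a + 2) z) z := by
  have hz0 := Complex.slitPlane_ne_zero hz
  induction n with
  | zero =>
    have h := (hasDerivAt_W a hz).sub_const (pcoef 0 a)
    rw [R_zero]
    refine h.congr_of_eventuallyEq (Eventually.of_forall fun w => ?_)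
    rw [R_succ, R_zero]
    simp
  | succ n ih =>
    have hp : HasDerivAt (fun w : ℂ => pcoef (n + 1) a / w ^ (2 * (n + 1)))
        (-(2 * (n + 1) * pcoef (n + 1) a) / z ^ (2 * n + 3)) z := by
      have h := ((hasDerivAt_pow (2 * (n + 1)) z).inv (pow_ne_zero _ hz0)).const_mul
        (pcoef (n + 1) a)
      simp only [Pi.inv_apply, ← div_eq_mul_inv] at h
      refine h.congr_deriv ?_
      rw [show 2 * (n + 1) - 1 = 2 * n + 1 by omega]
      push_cast
      field_simp
      ring
    have h := ih.sub hp
    rw [pcoef_succ] at h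
    refine (h.congr_deriv ?_).congr_of_eventuallyEq
      (Eventually.of_forall fun w => R_succ (n + 1) a w)
    rw [R_succ n]
    field_simp
    ring

/-! ### Boundedness of the remainder in sectors interior to the right half-plane -/

theorem abs_exp_neg_sub_sum_le (n : ℕ) {w : ℝ} (hw : 0 ≤ w) :
    |Real.exp (-w) - ∑ s ∈ Finset.range n, (-w) ^ s / (s.factorial : ℝ)| ≤
      w ^ n / (n.factorial : ℝ) := by
  -- The signed Taylor remainders satisfy h_{n+1}' = h_n and h_{n+1}(0) = 0, so all are nonnegative
  -- on w ≥ 0. Since h_n + h_{n+1} = w^n/n!, each is at most w^n/n!.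
  let h : ℕ → ℝ → ℝ := fun n w =>
    (-1) ^ n * (Real.exp (-w) - ∑ s ∈ Finset.range n, (-w) ^ s / (s.factorial : ℝ))
  have hsucc : ∀ n w, h n w + h (n + 1) w = w ^ n / (n.factorial : ℝ) := by
    intro n w
    simp only [h, Finset.sum_range_succ, neg_pow w n, pow_succ]
    have h1 : ((-1 : ℝ) ^ n) * (-1) ^ n = 1 := by rw [← mul_pow]; simp
    linear_combination (w ^ n / (n.factorial : ℝ)) * h1
  have hder : ∀ n w, HasDerivAt (h (n + 1)) (h n w) w := by
    intro n
    induction n with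
    | zero =>
      intro w
      have h0 := ((hasDerivAt_neg w).exp.sub_const 1).const_mul (-1 : ℝ)
      simpa [h] using h0
    | succ n ih =>
      intro w
      have h0 := ((hasDerivAt_pow (n + 1) w).div_const ((n + 1).factorial : ℝ)).sub (ih w)
      refine (h0.congr_deriv ?_).congr_of_eventuallyEq (Eventually.of_forall fun w => ?_)
      · rw [eq_sub_of_add_eq' (hsucc n w), Nat.factorial_succ]
        have h1 : (n.factorial : ℝ) ≠ 0 := by positivity
        push_cast
        field_simp
      · exact eq_sub_of_add_eq' (hsucc (n + 1) w)
  have hnn : ∀ n w, 0 ≤ w → 0 ≤ h n w := by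
    intro n
    induction n with
    | zero =>
      intro w _
      simpa [h] using (Real.exp_pos (-w)).le
    | succ n ih =>
      intro w hw
      have hm : MonotoneOn (h (n + 1)) (Ici 0) := by
        refine monotoneOn_of_deriv_nonneg (convex_Ici 0)
          (fun x _ => (hder n x).continuousAt.continuousWithinAt)
          (fun x _ => (hder n x).differentiableAt.differentiableWithinAt) fun x hx => ?_
        rw [(hder n x).deriv]
        exact ih x (by simpa using (interior_subset hx))
      have h0 : h (n + 1) 0 = 0 := by
        simp [h, Finset.sum_range_succ']
      rw [← h0]
      exact hm self_mem_Ici hw hw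
  have habs : |Real.exp (-w) - ∑ s ∈ Finset.range n, (-w) ^ s / (s.factorial : ℝ)| = h n w := by
    rw [← abs_of_nonneg (hnn n w hw)]
    simp [h, abs_mul, abs_pow]
  rw [habs, ← hsucc n w]
  linarith [hnn (n + 1) w hw]

theorem Gamma_add_natCast_eq {c : ℝ} (hc : 0 < c) (n : ℕ) :
    (Real.Gamma (c + n) : ℂ) = Real.Gamma c * (ascPochhammer ℂ n).eval (c : ℂ) := by
  induction n with
  | zero => simp
  | succ n ih =>
    have h : c + n ≠ 0 := by positivity
    rw [Nat.cast_succ, ← add_assoc, Real.Gamma_add_one h, ascPochhammer_succ_eval, ← mul_assoc,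
      ← ih]
    push_cast
    ring

/-- The remainder is the Laplace transform of t^{c-1} times the Taylor remainder of e^{-t²/2}. The
bound degenerates as Re z → 0; only its qualitative consequence in sectors is used. -/
theorem norm_R_le_of_pos {a : ℝ} (ha : -(1 / 2) < a) (n : ℕ) {z : ℂ} (hz : 0 < z.re) :
    ‖R n a z‖ ≤ Real.Gamma (a + 1 / 2 + 2 * n) / (Real.Gamma (a + 1 / 2) * 2 ^ n * n.factorial) *
      (‖z‖ / z.re) ^ (a + 1 / 2) / z.re ^ (2 * n) := by
  set c : ℝ := a + 1 / 2 with hc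
  have hcpos : 0 < c := by linarith
  have hz0 : z ≠ 0 := fun h => by simp [h] at hz
  have hG : 0 < Real.Gamma c := Real.Gamma_pos_of_pos hcpos
  have hGC : (Real.Gamma c : ℂ) ≠ 0 := by exact_mod_cast hG.ne'
  have hcC : ((a : ℂ) + 1 / 2) = (c : ℂ) := by rw [hc]; push_cast; ring
  have hcs : ∀ s : ℕ, 0 < c + 2 * s := fun s => by positivity
  have hterm : ∀ s : ℕ, (Real.Gamma c : ℂ) * (pcoef s a / z ^ (2 * s)) = z ^ (c : ℂ) *
      ∫ t : ℝ in Ioi 0, ((t ^ (c + 2 * s - 1) : ℝ) : ℂ) * Complex.exp (-z * t) *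
        ((-1 / 2) ^ s / (s.factorial : ℂ)) := by
    intro s
    have h2 := Gamma_add_natCast_eq hcpos (2 * s)
    push_cast at h2
    have h3 : z ^ (c : ℂ) * z ^ (-((c + 2 * s : ℝ) : ℂ)) = (z ^ (2 * s))⁻¹ := by
      rw [← Complex.cpow_add _ _ hz0, ← Complex.cpow_natCast, ← Complex.cpow_neg]
      congr 1
      push_cast
      ring
    have h1 : (s.factorial : ℂ) ≠ 0 := by exact_mod_cast s.factorial_ne_zero
    rw [integral_mul_const, integral_rpow_mul_cexp_neg_mul (hcs s) hz, h2, pcoef, hcC,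
      show (-1 / 2 : ℂ) ^ s = (-1) ^ s / 2 ^ s by rw [div_pow], div_eq_mul_inv _ (z ^ _), ← h3]
    field_simp
  have hintT : ∀ s : ℕ, IntegrableOn (fun t : ℝ => ((t ^ (c + 2 * s - 1) : ℝ) : ℂ) *
      Complex.exp (-z * t) * ((-1 / 2) ^ s / (s.factorial : ℂ))) (Ioi 0) := fun s =>
    (integrableOn_rpow_mul_cexp_neg_mul (hcs s) hz).mul_const _
  have hintV : IntegrableOn (fun t : ℝ => ((t ^ (c - 1) * Real.exp (-(1 / 2) * t ^ 2) : ℝ) : ℂ) *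
      Complex.exp (-z * t)) (Ioi 0) := by
    refine (integrableOn_rpow_mul_exp_neg_mul hcpos hz).mono' ?_ ?_
    · apply Measurable.aestronglyMeasurable
      fun_prop
    · filter_upwards [ae_restrict_mem measurableSet_Ioi] with t ht
      have ht' : (0 : ℝ) < t := ht
      rw [norm_mul, norm_cexp_neg_mul_ofReal, Complex.norm_real,
        Real.norm_of_nonneg (by positivity)]
      gcongr
      have : Real.exp (-(1 / 2) * t ^ 2) ≤ 1 := Real.exp_le_one_iff.2 (by nlinarith)
      exact mul_le_of_le_one_right (by positivity) this
  have hR : (Real.Gamma c : ℂ) * R n a z = z ^ (c : ℂ) * ∫ t : ℝ in Ioi 0,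
      ((t ^ (c - 1) * (Real.exp (-(t ^ 2 / 2)) -
        ∑ s ∈ Finset.range n, (-(t ^ 2 / 2)) ^ s / (s.factorial : ℝ)) : ℝ) : ℂ) *
          Complex.exp (-z * t) := by
    rw [R_eq_W_sub, W, poincareSum_eq, mul_sub, Finset.mul_sum,
      Finset.sum_congr rfl fun s _ => hterm s, ← Finset.mul_sum, mul_left_comm, Gamma_mul_V ha,
      ← hc, hcC, ← mul_sub, ← integral_finsetSum _ fun s _ => hintT s,
      ← integral_sub hintV (integrable_finsetSum _ fun s _ => hintT s)]
    congr 1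
    refine setIntegral_congr_fun measurableSet_Ioi fun t ht => ?_
    have ht' : (0 : ℝ) < t := ht
    have hs : ∀ s : ℕ, t ^ (c + 2 * s - 1) = t ^ (c - 1) * t ^ (2 * s) := fun s => by
      rw [← Real.rpow_add_natCast ht'.ne']
      congr 1
      push_cast
      ring
    simp only [hs]
    rw [show -(1 / 2) * t ^ 2 = -(t ^ 2 / 2) by ring, mul_sub, Complex.ofReal_sub, sub_mul,
      Complex.ofReal_mul _ (∑ _ ∈ _, _), Complex.ofReal_sum, Finset.mul_sum, Finset.sum_mul]
    congr 1
    refine Finset.sum_congr rfl fun s _ => ?_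
    rw [show -(t ^ 2 / 2) = t ^ 2 * (-1 / 2) by ring, mul_pow, ← pow_mul]
    push_cast
    ring
  have hbound : ‖∫ t : ℝ in Ioi 0, ((t ^ (c - 1) * (Real.exp (-(t ^ 2 / 2)) -
        ∑ s ∈ Finset.range n, (-(t ^ 2 / 2)) ^ s / (s.factorial : ℝ)) : ℝ) : ℂ) *
          Complex.exp (-z * t)‖ ≤
      (1 / z.re) ^ (c + 2 * n) * Real.Gamma (c + 2 * n) * (1 / (2 ^ n * n.factorial)) := by
    rw [← Real.integral_rpow_mul_exp_neg_mul_Ioi (hcs n) hz, ← integral_mul_const]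
    refine norm_integral_le_of_norm_le ?_ ?_
    · simpa only [neg_mul] using (integrableOn_rpow_mul_exp_neg_mul (hcs n) hz).mul_const _
    · filter_upwards [ae_restrict_mem measurableSet_Ioi] with t ht
      have ht' : (0 : ℝ) < t := ht
      have h1 := abs_exp_neg_sub_sum_le n (show 0 ≤ t ^ 2 / 2 by positivity)
      have hs : t ^ (c + 2 * n - 1) = t ^ (c - 1) * t ^ (2 * n) := by
        rw [← Real.rpow_add_natCast ht'.ne']
        congr 1
        push_cast
        ring
      rw [norm_mul, norm_cexp_neg_mul_ofReal, Complex.norm_real, Real.norm_eq_abs, abs_mul,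
        abs_of_pos (Real.rpow_pos_of_pos ht' _), hs, neg_mul]
      calc _ ≤ t ^ (c - 1) * ((t ^ 2 / 2) ^ n / n.factorial) * Real.exp (-(z.re * t)) := by gcongr
        _ = _ := by
          rw [div_pow, ← pow_mul]
          field_simp
  have hnorm := congrArg norm hR
  rw [norm_mul, norm_mul, Complex.norm_real, Real.norm_of_nonneg hG.le,
    Complex.norm_cpow_of_ne_zero hz0] at hnorm
  simp only [Complex.ofReal_re, Complex.ofReal_im, mul_zero, Real.exp_zero, div_one] at hnorm
  have hfin : Real.Gamma c * ‖R n a z‖ ≤ ‖z‖ ^ c *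
      ((1 / z.re) ^ (c + 2 * n) * Real.Gamma (c + 2 * n) * (1 / (2 ^ n * n.factorial))) := by
    rw [hnorm]
    gcongr
  rw [← le_div_iff₀' hG] at hfin
  refine hfin.trans (le_of_eq ?_)
  have e : (1 / z.re) ^ (c + 2 * n) = (1 / z.re) ^ c * (1 / z.re ^ (2 * n)) := by
    rw [show c + 2 * (n : ℝ) = c + ((2 * n : ℕ) : ℝ) by push_cast; ring,
      Real.rpow_add_natCast (by positivity), one_div_pow]
  rw [e, div_eq_mul_one_div ‖z‖, Real.mul_rpow (norm_nonneg z) (by positivity)]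
  field_simp

/-- The remainder of order `n` is `O(|z|^{-2n})` in sectors interior to the right half-plane. -/
def SectorBounded (n : ℕ) (a : ℝ) : Prop :=
  ∀ q : ℝ, ∃ C : ℝ, ∀ z : ℂ, 1 ≤ ‖z‖ → 0 < z.re → ‖z‖ ≤ q * z.re → ‖R n a z‖ * ‖z‖ ^ (2 * n) ≤ C

theorem sectorBounded_of_pos {a : ℝ} (ha : -(1 / 2) < a) (n : ℕ) : SectorBounded n a := by
  intro q
  have hG : 0 < Real.Gamma (a + 1 / 2) := Real.Gamma_pos_of_pos (by linarith)
  have hG' : 0 < Real.Gamma (a + 1 / 2 + 2 * n) := Real.Gamma_pos_of_pos (by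
    have : (0 : ℝ) ≤ n := Nat.cast_nonneg n
    linarith)
  refine ⟨Real.Gamma (a + 1 / 2 + 2 * n) / (Real.Gamma (a + 1 / 2) * 2 ^ n * n.factorial) *
    q ^ (a + 1 / 2) * q ^ (2 * n), fun z _ hz hq => ?_⟩
  have hq' : ‖z‖ / z.re ≤ q := (div_le_iff₀ hz).2 hq
  calc ‖R n a z‖ * ‖z‖ ^ (2 * n) ≤ Real.Gamma (a + 1 / 2 + 2 * n) /
        (Real.Gamma (a + 1 / 2) * 2 ^ n * n.factorial) *
          (‖z‖ / z.re) ^ (a + 1 / 2) / z.re ^ (2 * n) * ‖z‖ ^ (2 * n) := by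
        gcongr
        exact norm_R_le_of_pos ha n hz
    _ = Real.Gamma (a + 1 / 2 + 2 * n) /
        (Real.Gamma (a + 1 / 2) * 2 ^ n * n.factorial) *
          (‖z‖ / z.re) ^ (a + 1 / 2) * (‖z‖ / z.re) ^ (2 * n) := by
        rw [div_pow]
        ring
    _ ≤ _ := by
        have : 0 ≤ a + 1 / 2 := by linarith
        have hq0 : 0 ≤ q := (by positivity : 0 ≤ ‖z‖ / z.re).trans hq'
        gcongr

theorem sectorBounded_of_recurrence {a : ℝ} (h1 : ∀ n, SectorBounded n (a + 1))
    (h2 : ∀ n, SectorBounded n (a + 2)) (n : ℕ) : SectorBounded n a := by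
  intro q
  -- The auxiliary order m treats n = 0 (with m = 0) and n = m+1 together; |z| ≥ 1 absorbs the
  -- surplus power.
  have key : ∀ m : ℕ, (∀ z : ℂ, z ≠ 0 → R n a z = R n ((a + 1 : ℝ) : ℂ) z +
      ((a + 3 / 2 : ℝ) : ℂ) / z ^ 2 * R m ((a + 2 : ℝ) : ℂ) z) → n ≤ m + 1 →
      ∃ C : ℝ, ∀ z : ℂ, 1 ≤ ‖z‖ → 0 < z.re → ‖z‖ ≤ q * z.re →
        ‖R n a z‖ * ‖z‖ ^ (2 * n) ≤ C := by
    intro m hm hnm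
    obtain ⟨C₁, hC₁⟩ := h1 n q
    obtain ⟨C₂, hC₂⟩ := h2 m q
    refine ⟨C₁ + |a + 3 / 2| * C₂, fun z hz hre hq => ?_⟩
    have hz0 : z ≠ 0 := fun h => by simp [h] at hre
    have hzn : 0 < ‖z‖ := norm_pos_iff.2 hz0
    calc ‖R n a z‖ * ‖z‖ ^ (2 * n)
        ≤ (‖R n ((a + 1 : ℝ) : ℂ) z‖ + |a + 3 / 2| / ‖z‖ ^ 2 * ‖R m ((a + 2 : ℝ) : ℂ) z‖) *
          ‖z‖ ^ (2 * n) := by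
          gcongr
          rw [hm z hz0]
          refine (norm_add_le _ _).trans (le_of_eq ?_)
          rw [norm_mul, norm_div, Complex.norm_real, norm_pow, Real.norm_eq_abs]
      _ = ‖R n ((a + 1 : ℝ) : ℂ) z‖ * ‖z‖ ^ (2 * n) +
          |a + 3 / 2| * (‖R m ((a + 2 : ℝ) : ℂ) z‖ * (‖z‖ ^ (2 * n) / ‖z‖ ^ 2)) := by
          ring
      _ ≤ ‖R n ((a + 1 : ℝ) : ℂ) z‖ * ‖z‖ ^ (2 * n) +
          |a + 3 / 2| * (‖R m ((a + 2 : ℝ) : ℂ) z‖ * ‖z‖ ^ (2 * m)) := by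
          gcongr
          rw [div_le_iff₀ (by positivity), ← pow_add]
          exact pow_le_pow_right₀ hz (by omega)
      _ ≤ _ := by
          gcongr
          · exact hC₁ z hz hre hq
          · exact hC₂ z hz hre hq
  cases n with
  | zero =>
    refine key 0 (fun z hz => ?_) (by omega)
    rw [R_zero_recurrence _ hz]
    push_cast
    rfl
  | succ n =>
    refine key n (fun z hz => ?_) le_rfl
    rw [R_recurrence _ _ hz]
    push_cast
    rfl

theorem sectorBounded (n : ℕ) (a : ℝ) : SectorBounded n a := by
  have key : ∀ k : ℕ, ∀ a : ℝ, -(1 / 2) - (k : ℝ) < a → ∀ n, SectorBounded n a := by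
    intro k
    induction k with
    | zero => exact fun a ha => sectorBounded_of_pos (by simpa using ha)
    | succ k ih =>
      intro a ha
      push_cast at ha
      exact sectorBounded_of_recurrence (ih _ (by linarith)) (ih _ (by linarith))
  obtain ⟨k, hk⟩ := exists_nat_gt (-(1 / 2) - a)
  exact key k a (by linarith) n

/-! ### Bounds from infinity for solutions of second order equations -/

/-- On [τ, T] the change of φ is at most ψ(τ) - ψ(T) ≤ ψ(τ); then T → ∞. The limit of ψ itself is
not needed. -/
theorem norm_le_of_norm_deriv_le_neg_deriv {E : Type*} [NormedAddCommGroup E] [NormedSpace ℝ E]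
    {φ φ' : ℝ → E} {ψ ψ' : ℝ → ℝ} {τ : ℝ} (hφ : ∀ v, τ ≤ v → HasDerivAt φ (φ' v) v)
    (hψ : ∀ v, τ ≤ v → HasDerivAt ψ (ψ' v) v) (hb : ∀ v, τ ≤ v → ‖φ' v‖ ≤ -ψ' v)
    (hlim : Tendsto φ atTop (𝓝 0)) (hψ0 : ∀ v, τ ≤ v → 0 ≤ ψ v) : ‖φ τ‖ ≤ ψ τ := by
  have key : ∀ T, τ ≤ T → ‖φ T - φ τ‖ ≤ ψ τ := by
    intro T hT
    have h := image_norm_le_of_norm_deriv_right_le_deriv_boundary'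
      (f := fun x => φ x - φ τ) (f' := φ') (a := τ) (b := T)
      (B := fun x => ψ τ - ψ x) (B' := fun x => -ψ' x)
      (fun x hx => ((hφ x hx.1).continuousAt.sub continuousAt_const).continuousWithinAt)
      (fun x hx => ((hφ x hx.1).sub_const _).hasDerivWithinAt) (by simp)
      (fun x hx => (continuousAt_const.sub (hψ x hx.1).continuousAt).continuousWithinAt)
      (fun x hx => ((hψ x hx.1).const_sub _).hasDerivWithinAt)
      (fun x hx => hb x hx.1) (right_mem_Icc.2 hT)
    exact h.trans (by linarith [hψ0 T hT])
  have hl : Tendsto (fun T => ‖φ T - φ τ‖) atTop (𝓝 ‖0 - φ τ‖) := (hlim.sub_const _).norm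
  rw [zero_sub, norm_neg] at hl
  exact le_of_tendsto hl ((eventually_ge_atTop τ).mono key)

/-- The tail `∫_τ^∞ (r² + v²)^{-n} dv`. -/
def powTail (r : ℝ) (n : ℕ) (τ : ℝ) : ℝ := ∫ v in Ioi τ, ((r ^ 2 + v ^ 2) ^ n)⁻¹

theorem continuous_inv_sq_add_sq_pow {r : ℝ} (hr : 1 ≤ r) (n : ℕ) :
    Continuous fun v : ℝ => ((r ^ 2 + v ^ 2) ^ n)⁻¹ :=
  Continuous.inv₀ (by fun_prop) fun v => by positivity

theorem integrable_inv_sq_add_sq_pow {r : ℝ} (hr : 1 ≤ r) {n : ℕ} (hn : n ≠ 0) :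
    Integrable fun v : ℝ => ((r ^ 2 + v ^ 2) ^ n)⁻¹ := by
  refine integrable_inv_one_add_sq.mono'
    (continuous_inv_sq_add_sq_pow hr n).aestronglyMeasurable (Eventually.of_forall fun v => ?_)
  rw [Real.norm_of_nonneg (by positivity)]
  have h1 : 1 + v ^ 2 ≤ r ^ 2 + v ^ 2 := by nlinarith
  have h2 : 1 ≤ r ^ 2 + v ^ 2 := by nlinarith [sq_nonneg v]
  gcongr
  exact h1.trans (le_self_pow₀ h2 hn)

theorem powTail_eq {r : ℝ} (hr : 1 ≤ r) {n : ℕ} (hn : n ≠ 0) (τ : ℝ) :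
    powTail r n τ = powTail r n 0 - ∫ v in (0 : ℝ)..τ, ((r ^ 2 + v ^ 2) ^ n)⁻¹ := by
  have h := integrable_inv_sq_add_sq_pow hr hn
  rw [powTail, powTail, ← intervalIntegral.integral_Ioi_sub_Ioi' h.integrableOn h.integrableOn,
    sub_sub_cancel]

theorem hasDerivAt_powTail {r : ℝ} (hr : 1 ≤ r) {n : ℕ} (hn : n ≠ 0) (τ : ℝ) :
    HasDerivAt (powTail r n) (-((r ^ 2 + τ ^ 2) ^ n)⁻¹) τ := by
  have hc := continuous_inv_sq_add_sq_pow hr n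
  have h := (intervalIntegral.integral_hasDerivAt_right (hc.intervalIntegrable 0 τ)
    (hc.stronglyMeasurableAtFilter _ _) hc.continuousAt).const_sub (powTail r n 0)
  exact h.congr_of_eventuallyEq (Eventually.of_forall (powTail_eq hr hn))

theorem tendsto_powTail {r : ℝ} (hr : 1 ≤ r) {n : ℕ} (hn : n ≠ 0) :
    Tendsto (powTail r n) atTop (𝓝 0) := by
  have h := (intervalIntegral_tendsto_integral_Ioi 0
    (integrable_inv_sq_add_sq_pow hr hn).integrableOn tendsto_id).const_sub (powTail r n 0)
  simp only [id] at h
  rw [← powTail, sub_self] at h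
  exact h.congr fun τ => (powTail_eq hr hn τ).symm

theorem powTail_nonneg (r : ℝ) (n : ℕ) (τ : ℝ) : 0 ≤ powTail r n τ :=
  integral_nonneg fun v => by positivity

theorem hasDerivAt_inv_sq_add_sq_pow {r : ℝ} (hr : 1 ≤ r) {k : ℕ} (hk : k ≠ 0) (τ : ℝ) :
    HasDerivAt (fun v : ℝ => ((r ^ 2 + v ^ 2) ^ k)⁻¹ / (2 * k))
      (-(τ * ((r ^ 2 + τ ^ 2) ^ (k + 1))⁻¹)) τ := by
  obtain ⟨j, rfl⟩ := Nat.exists_eq_succ_of_ne_zero hk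
  have h0 : r ^ 2 + τ ^ 2 ≠ 0 := by positivity
  have h := ((((hasDerivAt_pow 2 τ).const_add (r ^ 2)).pow (j + 1)).inv
    (pow_ne_zero _ h0)).div_const (2 * ((j + 1 : ℕ) : ℝ))
  refine h.congr_deriv ?_
  have : ((j : ℝ) + 1) ≠ 0 := by positivity
  push_cast
  field_simp
  simp
  ring

/-- On the tail τ ≤ v, and v (r²+v²)^{-(k+1)} has an elementary antiderivative. -/
theorem mul_powTail_le {r : ℝ} (hr : 1 ≤ r) {k : ℕ} (hk : k ≠ 0) {τ : ℝ} (hτ : 0 ≤ τ) :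
    τ * powTail r (k + 1) τ ≤ ((r ^ 2 + τ ^ 2) ^ k)⁻¹ / (2 * k) := by
  refine (le_abs_self _).trans (norm_le_of_norm_deriv_le_neg_deriv
    (φ := fun v => τ * powTail r (k + 1) v)
    (ψ := fun v => ((r ^ 2 + v ^ 2) ^ k)⁻¹ / (2 * k))
    (fun v _ => (hasDerivAt_powTail hr k.add_one_ne_zero v).const_mul τ)
    (fun v _ => hasDerivAt_inv_sq_add_sq_pow hr hk v) (fun v hv => ?_) ?_
    (fun v _ => by positivity))
  · rw [norm_mul, norm_neg, Real.norm_of_nonneg hτ, Real.norm_of_nonneg (by positivity), neg_neg]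
    gcongr
  · simpa using (tendsto_powTail hr k.add_one_ne_zero).const_mul τ

theorem sq_norm_add_sq_le {z : ℂ} (hz : 0 ≤ z.re) {v : ℝ} (hv : 0 ≤ v) :
    ‖z‖ ^ 2 + v ^ 2 ≤ ‖z + v‖ ^ 2 := by
  rw [← Complex.normSq_eq_norm_sq, ← Complex.normSq_eq_norm_sq, Complex.normSq_apply,
    Complex.normSq_apply]
  simp only [Complex.add_re, Complex.ofReal_re, Complex.add_im, Complex.ofReal_im, add_zero]
  nlinarith [mul_nonneg hz hv]

theorem norm_add_ofReal_mono {z : ℂ} (hz : 0 ≤ z.re) {τ v : ℝ} (hτ : 0 ≤ τ) (hv : τ ≤ v) :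
    ‖z + τ‖ ≤ ‖z + v‖ := by
  have h := sq_norm_add_sq_le (z := z + τ) (by simp; linarith) (sub_nonneg.2 hv)
  rw [show z + τ + ((v - τ : ℝ) : ℂ) = z + v by push_cast; ring] at h
  exact le_of_sq_le_sq (by nlinarith [sq_nonneg (v - τ)]) (norm_nonneg _)

/-- A bound for a solution of `(f' e)' = F e` that vanishes at infinity, where the weight `e` is
decreasing up to a power. -/
theorem norm_le_of_second_order {z : ℂ} (hz : 0 ≤ z.re) (hz1 : 1 ≤ ‖z‖) {f f' F e : ℝ → ℂ}
    {B : ℝ} {m k : ℕ} (hk : k ≠ 0) (hf : ∀ τ, 0 ≤ τ → HasDerivAt f (f' τ) τ)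
    (hfe : ∀ τ, 0 ≤ τ → HasDerivAt (fun τ => f' τ * e τ) (F τ * e τ) τ)
    (hf0 : Tendsto f atTop (𝓝 0)) (hfe0 : Tendsto (fun τ => f' τ * e τ) atTop (𝓝 0))
    (he : ∀ τ, 0 ≤ τ → e τ ≠ 0)
    (hem : ∀ τ v, 0 ≤ τ → τ ≤ v → ‖e v‖ ≤ ‖e τ‖ * (‖z + v‖ / ‖z‖) ^ (2 * m))
    (hB : 0 ≤ B) (hF : ∀ τ : ℝ, 0 ≤ τ → ‖F τ‖ ≤ B / ‖z + τ‖ ^ (2 * (m + k + 1))) :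
    ‖f 0‖ ≤ B / (2 * k) / ‖z‖ ^ (2 * (m + k)) := by
  set r := ‖z‖ with hr
  have hr0 : 0 < r := by linarith
  -- First integration: the power of |z+v| by which the weight may grow is paid for by 2m of the
  -- powers in the bound on F.
  have hf' : ∀ τ, 0 ≤ τ → ‖f' τ‖ ≤ B / r ^ (2 * m) * powTail r (k + 1) τ := by
    intro τ hτ
    have heτ : 0 < ‖e τ‖ := norm_pos_iff.2 (he τ hτ)
    have h := norm_le_of_norm_deriv_le_neg_deriv (τ := τ)
      (ψ := fun v => ‖e τ‖ * (B / r ^ (2 * m)) * powTail r (k + 1) v)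
      (fun v hv => hfe v (hτ.trans hv))
      (fun v _ => (hasDerivAt_powTail hz1 k.add_one_ne_zero v).const_mul _) (fun v hv => ?_) hfe0
      (fun v _ => mul_nonneg (by positivity) (powTail_nonneg _ _ _))
    · rw [norm_mul, mul_comm, mul_assoc] at h
      exact le_of_mul_le_mul_left h heτ
    · have hv0 : 0 ≤ v := hτ.trans hv
      have hzv : 0 < ‖z + v‖ :=
        hr0.trans_le (by simpa using norm_add_ofReal_mono hz le_rfl hv0)
      rw [norm_mul]
      calc ‖F v‖ * ‖e v‖ ≤ B / ‖z + v‖ ^ (2 * (m + k + 1)) *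
            (‖e τ‖ * (‖z + v‖ / r) ^ (2 * m)) := by
            gcongr
            · exact hF v hv0
            · exact hem τ v hτ hv
        _ = ‖e τ‖ * (B / r ^ (2 * m)) * ((‖z + v‖ ^ 2) ^ (k + 1))⁻¹ := by
            rw [show 2 * (m + k + 1) = 2 * m + 2 * (k + 1) by ring, pow_add, div_pow, ← pow_mul]
            field_simp
        _ ≤ ‖e τ‖ * (B / r ^ (2 * m)) * ((r ^ 2 + v ^ 2) ^ (k + 1))⁻¹ := by
            gcongr
            exact sq_norm_add_sq_le hz hv0
        _ = _ := by ring
  -- Second integration: this ψ is the integral of the bound for f' over (v, ∞), found by parts; at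
  -- v = 0 only the elementary term survives.
  have h := norm_le_of_norm_deriv_le_neg_deriv (τ := 0)
    (ψ := fun v => B / r ^ (2 * m) *
      (((r ^ 2 + v ^ 2) ^ k)⁻¹ / (2 * k) - v * powTail r (k + 1) v)) hf
    (fun v _ => ((hasDerivAt_inv_sq_add_sq_pow hz1 hk v).sub
      ((hasDerivAt_id v).mul (hasDerivAt_powTail hz1 k.add_one_ne_zero v))).const_mul _)
    (fun v hv => (hf' v hv).trans (le_of_eq (by simp only [id]; ring))) hf0
    (fun v hv => mul_nonneg (by positivity) (sub_nonneg.2 (mul_powTail_le hz1 hk hv)))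
  refine h.trans (le_of_eq ?_)
  have : (k : ℝ) ≠ 0 := by exact_mod_cast hk
  simp only [zero_mul, sub_zero, ne_eq, OfNat.ofNat_ne_zero, not_false_eq_true, zero_pow, add_zero]
  rw [← pow_mul, mul_add 2 m k, pow_add]
  field_simp

/-! ### The remainder in the right half-plane -/

/-- The weight `z^{-2c} e^{-z²/2}`. -/
def weight (c : ℝ) (z : ℂ) : ℂ := z ^ ((-(2 * c) : ℝ) : ℂ) * Complex.exp (-z ^ 2 / 2)

theorem weight_ne_zero (c : ℝ) {z : ℂ} (hz : z ≠ 0) : weight c z ≠ 0 := by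
  rw [weight, Complex.cpow_def_of_ne_zero hz]
  exact mul_ne_zero (Complex.exp_ne_zero _) (Complex.exp_ne_zero _)

/-- Since Re z² = |z|² - 2 (Im z)², along a horizontal line the modulus depends on |z| alone. -/
theorem norm_weight (c : ℝ) {z : ℂ} (hz : z ≠ 0) :
    ‖weight c z‖ = ‖z‖ ^ (-(2 * c)) * Real.exp (-(‖z‖ ^ 2 / 2)) * Real.exp (z.im ^ 2) := by
  have h : (-z ^ 2 / 2).re = -(‖z‖ ^ 2 / 2) + z.im ^ 2 := by
    rw [← Complex.normSq_eq_norm_sq, Complex.normSq_apply]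
    simp [pow_two]
    ring
  rw [weight, norm_mul, Complex.norm_cpow_of_ne_zero hz, Complex.norm_exp, h, Real.exp_add]
  simp [mul_assoc]

theorem hasDerivAt_weight (c : ℝ) {z : ℂ} (hz : z ∈ Complex.slitPlane) :
    HasDerivAt (weight c) (-(2 * c / z + z) * weight c z) z := by
  have hz0 := Complex.slitPlane_ne_zero hz
  have h := ((hasDerivAt_id z).cpow_const (c := ((-(2 * c) : ℝ) : ℂ)) hz).mul
    (((hasDerivAt_pow 2 z).neg.div_const 2).cexp)
  refine h.congr_deriv ?_
  simp only [id, weight, Complex.cpow_sub _ _ hz0, Complex.cpow_one, Pi.neg_apply]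
  push_cast
  field_simp
  ring

theorem norm_weight_add_le {c : ℝ} {m : ℕ} (hm : -(m : ℝ) ≤ c) {z : ℂ} (hz : 0 < z.re) {τ v : ℝ}
    (hτ : 0 ≤ τ) (hv : τ ≤ v) :
    ‖weight c (z + v)‖ ≤ ‖weight c (z + τ)‖ * (‖z + v‖ / ‖z‖) ^ (2 * m) := by
  have hz0 : 0 < ‖z‖ := norm_pos_iff.2 fun h => by simp [h] at hz
  have h1 : ‖z‖ ≤ ‖z + τ‖ := by simpa using norm_add_ofReal_mono hz.le le_rfl hτ
  have h2 : ‖z + τ‖ ≤ ‖z + v‖ := norm_add_ofReal_mono hz.le hτ hv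
  have hτ0 : 0 < ‖z + τ‖ := hz0.trans_le h1
  have hv0 : 0 < ‖z + v‖ := hτ0.trans_le h2
  have hp : ‖z + v‖ ^ (-(2 * c)) ≤ ‖z + τ‖ ^ (-(2 * c)) * (‖z + v‖ / ‖z‖) ^ (2 * m) := by
    have e : ‖z + v‖ ^ (-(2 * c)) =
        ‖z + τ‖ ^ (-(2 * c)) * (‖z + v‖ / ‖z + τ‖) ^ (-(2 * c)) := by
      rw [← Real.mul_rpow hτ0.le (by positivity), mul_div_cancel₀ _ hτ0.ne']
    have hq : 1 ≤ ‖z + v‖ / ‖z + τ‖ := (one_le_div hτ0).2 h2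
    rw [e]
    gcongr
    calc (‖z + v‖ / ‖z + τ‖) ^ (-(2 * c)) ≤ (‖z + v‖ / ‖z + τ‖) ^ (((2 * m : ℕ) : ℝ)) :=
          Real.rpow_le_rpow_of_exponent_le hq (by push_cast; linarith)
      _ = (‖z + v‖ / ‖z + τ‖) ^ (2 * m) := Real.rpow_natCast _ _
      _ ≤ _ := by gcongr
  rw [norm_weight c (norm_pos_iff.1 hv0), norm_weight c (norm_pos_iff.1 hτ0)]
  have him : (z + v).im = (z + τ).im := by simp
  rw [him]
  calc _ ≤ ‖z + τ‖ ^ (-(2 * c)) * (‖z + v‖ / ‖z‖) ^ (2 * m) * Real.exp (-(‖z + τ‖ ^ 2 / 2)) *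
        Real.exp ((z + τ).im ^ 2) := by gcongr
    _ = _ := by ring

theorem tendsto_norm_add_ofReal (z : ℂ) : Tendsto (fun τ : ℝ => ‖z + τ‖) atTop atTop := by
  refine tendsto_atTop_mono (fun τ => ?_) (tendsto_atTop_add_const_left _ z.re tendsto_id)
  simpa using Complex.re_le_norm (z + τ)

theorem tendsto_weight_add (c : ℝ) (z : ℂ) :
    Tendsto (fun τ : ℝ => weight c (z + τ)) atTop (𝓝 0) := by
  obtain ⟨m, hm⟩ := exists_nat_gt (-c)
  have hn := tendsto_norm_add_ofReal z
  have hu : Tendsto (fun τ : ℝ => ‖z + τ‖ ^ 2 / 2) atTop atTop :=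
    ((tendsto_pow_atTop two_ne_zero).comp hn).atTop_div_const two_pos
  have hl := ((Real.tendsto_pow_mul_exp_neg_atTop_nhds_zero m).comp hu).const_mul
    (2 ^ m * Real.exp (z.im ^ 2))
  rw [mul_zero] at hl
  refine squeeze_zero_norm' ?_ hl
  filter_upwards [hn.eventually_ge_atTop 1] with τ hτ
  have h0 : z + τ ≠ 0 := norm_pos_iff.1 (by linarith)
  rw [norm_weight c h0]
  have h1 : ‖z + τ‖ ^ (-(2 * c)) ≤ ‖z + τ‖ ^ (2 * m) := by
    rw [← Real.rpow_natCast]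
    exact Real.rpow_le_rpow_of_exponent_le hτ (by push_cast; linarith)
  calc _ ≤ ‖z + τ‖ ^ (2 * m) * Real.exp (-(‖z + τ‖ ^ 2 / 2)) * Real.exp ((z + τ).im ^ 2) := by
        gcongr
    _ = _ := by
        simp only [Function.comp, Complex.add_im, Complex.ofReal_im, add_zero, div_pow, pow_mul]
        field_simp

theorem hasDerivAt_R_deriv_mul_weight (n : ℕ) (a : ℝ) {z : ℂ} (hz : z ∈ Complex.slitPlane) :
    HasDerivAt (fun w : ℂ => ((a : ℂ) + 1 / 2) * (a + 3 / 2) / w ^ 3 * R (n + 1) (a + 2) w *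
        weight (a + 1 / 2) w)
      (-(((a : ℂ) + 1 / 2) * (a + 3 / 2) / z ^ 2) *
        (pcoef (n + 1) (a + 2) / z ^ (2 * (n + 1)) + R (n + 2) a z) * weight (a + 1 / 2) z) z := by
  have hz0 := Complex.slitPlane_ne_zero hz
  have h3 : HasDerivAt (fun w : ℂ => ((a : ℂ) + 1 / 2) * (a + 3 / 2) / w ^ 3)
      (-3 * (((a : ℂ) + 1 / 2) * (a + 3 / 2)) / z ^ 4) z := by
    have h := ((hasDerivAt_pow 3 z).inv (pow_ne_zero _ hz0)).const_mul
      (((a : ℂ) + 1 / 2) * (a + 3 / 2))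
    simp only [Pi.inv_apply, ← div_eq_mul_inv] at h
    refine h.congr_deriv ?_
    push_cast
    field_simp
  have h := (h3.mul (hasDerivAt_R n ((a : ℂ) + 2) hz)).mul (hasDerivAt_weight (a + 1 / 2) hz)
  refine h.congr_deriv ?_
  have r1 := R_recurrence (n + 1) (a : ℂ) hz0
  have r2 := R_recurrence (n + 1) ((a : ℂ) + 1) hz0
  have r3 := R_recurrence n ((a : ℂ) + 2) hz0
  have r4 := R_succ (n + 1) ((a : ℂ) + 2) z
  simp only [show (a : ℂ) + 1 + 1 = a + 2 by ring, show (a : ℂ) + 1 + 2 = a + 3 by ring,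
    show (a : ℂ) + 2 + 1 = a + 3 by ring, show (a : ℂ) + 2 + 2 = a + 4 by ring] at r1 r2 r3 r4 ⊢
  -- The recurrences in a reduce everything to R_{n+1}(a+2) and R_n(a+4), the two functions that the
  -- product rule produces.
  have r5 : pcoef (n + 1) ((a : ℂ) + 2) / z ^ (2 * (n + 1)) + R (n + 2) (a : ℂ) z =
      R (n + 1) (a + 2) z * (1 + (2 * a + 4) / z ^ 2) -
        (a + 5 / 2) * (a + 7 / 2) / z ^ 4 * R n (a + 4) z := by
    rw [r1, r2, r4]
    have r3' : R (n + 1) ((a : ℂ) + 3) z =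
      R (n + 1) (a + 2) z - (a + 2 + 3 / 2) / z ^ 2 * R n (a + 4) z := by rw [r3]; ring
    rw [r3']
    field_simp
    ring
  simp only [Pi.mul_apply, r5]
  push_cast
  field_simp
  ring

theorem hasDerivAt_comp_add_ofReal {g : ℂ → ℂ} {g' z : ℂ} {τ : ℝ}
    (h : HasDerivAt g g' (z + τ)) : HasDerivAt (fun τ : ℝ => g (z + τ)) g' τ :=
  (HasDerivAt.comp_const_add z (τ : ℂ) h).comp_ofReal

theorem norm_R_le_of_forcing_le (n : ℕ) (a : ℝ) {m k : ℕ} (hm : -(m : ℝ) ≤ a + 1 / 2)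
    (hk : k ≠ 0) (hn : n + 2 = m + k + 1) {z : ℂ} (hz : 0 < z.re) (hz1 : 1 ≤ ‖z‖) {B : ℝ}
    (hB : 0 ≤ B)
    (hF : ∀ τ : ℝ, 0 ≤ τ → ‖-(((a : ℂ) + 1 / 2) * (a + 3 / 2) / (z + τ) ^ 2) *
      (pcoef (n + 1) (a + 2) / (z + τ) ^ (2 * (n + 1)) + R (n + 2) a (z + τ))‖ ≤
        B / ‖z + τ‖ ^ (2 * (n + 2))) :
    ‖R (n + 2) a z‖ ≤ B / (2 * k) / ‖z‖ ^ (2 * (m + k)) := by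
  have hre : ∀ τ : ℝ, 0 ≤ τ → 0 < (z + τ).re := fun τ hτ => by simp; linarith
  have hslit : ∀ τ : ℝ, 0 ≤ τ → z + τ ∈ Complex.slitPlane := fun τ hτ => Or.inl (hre τ hτ)
  have hnorm : ∀ τ : ℝ, 0 ≤ τ → 1 ≤ ‖z + τ‖ := fun τ hτ =>
    hz1.trans (by simpa using norm_add_ofReal_mono hz.le le_rfl hτ)
  have hq : ∀ τ : ℝ, 0 ≤ τ → ‖z + τ‖ ≤ (‖z‖ / z.re) * (z + τ).re := by
    intro τ hτ
    have h1 : 1 ≤ ‖z‖ / z.re := (one_le_div hz).2 (Complex.re_le_norm z)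
    calc ‖z + τ‖ ≤ ‖z‖ + τ := by
          simpa [abs_of_nonneg hτ] using norm_add_le z (τ : ℂ)
      _ ≤ ‖z‖ / z.re * z.re + ‖z‖ / z.re * τ := by
          rw [div_mul_cancel₀ _ hz.ne']
          nlinarith
      _ = _ := by simp; ring
  have hbd : ∀ (j : ℕ) (b : ℝ), ∃ C, 0 ≤ C ∧
      ∀ τ : ℝ, 0 ≤ τ → ‖R j b (z + τ)‖ ≤ C / ‖z + τ‖ ^ (2 * j) := by
    intro j b
    obtain ⟨C, hC⟩ := sectorBounded j b (‖z‖ / z.re)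
    have h := fun (τ : ℝ) hτ => hC (z + τ) (hnorm τ hτ) (hre τ hτ) (hq τ hτ)
    refine ⟨C, (by positivity : (0 : ℝ) ≤ _).trans (h 0 le_rfl), fun τ hτ => ?_⟩
    have := hnorm τ hτ
    exact (le_div_iff₀ (by positivity)).2 (h τ hτ)
  have key := norm_le_of_second_order hz.le hz1 (m := m) (k := k) hk (B := B)
    (f := fun τ : ℝ => R (n + 2) a (z + τ))
    (f' := fun τ : ℝ => ((a : ℂ) + 1 / 2) * (a + 3 / 2) / (z + τ) ^ 3 * R (n + 1) (a + 2) (z + τ))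
    (F := fun τ : ℝ => -(((a : ℂ) + 1 / 2) * (a + 3 / 2) / (z + τ) ^ 2) *
      (pcoef (n + 1) (a + 2) / (z + τ) ^ (2 * (n + 1)) + R (n + 2) a (z + τ)))
    (e := fun τ : ℝ => weight (a + 1 / 2) (z + τ))
    (fun τ hτ => hasDerivAt_comp_add_ofReal (hasDerivAt_R (n + 1) a (hslit τ hτ)))
    (fun τ hτ => hasDerivAt_comp_add_ofReal (hasDerivAt_R_deriv_mul_weight n a (hslit τ hτ)))
    ?_ ?_ (fun τ hτ => weight_ne_zero _ (Complex.slitPlane_ne_zero (hslit τ hτ)))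
    (fun τ v hτ hv => norm_weight_add_le hm hz hτ hv) hB (by rw [← hn]; exact hF)
  · simpa using key
  · obtain ⟨C, _, hC⟩ := hbd (n + 2) a
    have hl : Tendsto (fun τ : ℝ => C / ‖z + τ‖ ^ (2 * (n + 2))) atTop (𝓝 0) :=
      ((tendsto_pow_atTop (by omega)).comp (tendsto_norm_add_ofReal z)).const_div_atTop C
    exact squeeze_zero_norm' ((eventually_ge_atTop 0).mono hC) hl
  · obtain ⟨C, hC0, hC⟩ := hbd (n + 1) (a + 2)
    have hl := (tendsto_weight_add (a + 1 / 2) z).norm.const_mul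
      (‖((a : ℂ) + 1 / 2) * (a + 3 / 2)‖ * C)
    rw [norm_zero, mul_zero] at hl
    refine squeeze_zero_norm' ((eventually_ge_atTop 0).mono fun τ hτ => ?_) hl
    have h1 := hnorm τ hτ
    have h2 := hC τ hτ
    push_cast at h2
    rw [norm_mul, norm_mul, norm_div, norm_pow]
    gcongr
    · exact div_le_self (norm_nonneg _) (one_le_pow₀ h1)
    · exact h2.trans (div_le_self hC0 (one_le_pow₀ h1))

theorem norm_R_le (n : ℕ) (a : ℝ) {m k : ℕ} (hm : -(m : ℝ) ≤ a + 1 / 2)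
    (hn : n + 2 = m + k + 1) (hk : |(a + 1 / 2) * (a + 3 / 2)| < 2 * k) {z : ℂ} (hz : 0 < z.re)
    (hz1 : 1 ≤ ‖z‖) :
    ‖R (n + 2) a z‖ ≤ 2 * (n + 2) * ‖pcoef (n + 2) a‖ /
      (2 * k - |(a + 1 / 2) * (a + 3 / 2)|) / ‖z‖ ^ (2 * (n + 1)) := by
  set κ : ℝ := |(a + 1 / 2) * (a + 3 / 2)| with hκ
  have hκ0 : 0 ≤ κ := abs_nonneg _
  have hκC : ‖((a : ℂ) + 1 / 2) * (a + 3 / 2)‖ = κ := by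
    rw [hκ, ← Real.norm_eq_abs, ← Complex.norm_real]
    push_cast
    rfl
  have hk0 : k ≠ 0 := by
    rintro rfl
    simp at hk
    linarith
  set A : ℝ := 2 * (n + 2) * ‖pcoef (n + 2) a‖ with hA
  have hA0 : 0 ≤ A := by positivity
  have hAκ : κ * ‖pcoef (n + 1) ((a : ℂ) + 2)‖ = A := by
    have h := congrArg norm (pcoef_succ (n + 1) (a : ℂ))
    rw [norm_neg, norm_mul, norm_mul (_ * _) (pcoef (n + 1) _), hκC] at h
    rw [← h, hA]
    congr 1
    rw [show (2 : ℂ) * (((n + 1 : ℕ) : ℂ) + 1) = ((2 * (n + 2) : ℝ) : ℂ) by push_cast; ring,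
      Complex.norm_real, Real.norm_of_nonneg (by positivity)]
  set q : ℝ := ‖z‖ / z.re with hq
  -- D contains z and is closed under adding τ ≥ 0, so the supremum over D controls the forcing
  -- along every ray used.
  let D : Set ℂ := {w | 1 ≤ ‖w‖ ∧ 0 < w.re ∧ ‖w‖ ≤ q * w.re}
  have hzD : z ∈ D := ⟨hz1, hz, by rw [hq, div_mul_cancel₀ _ hz.ne']⟩
  have hq1 : 1 ≤ q := (one_le_div hz).2 (Complex.re_le_norm z)
  have hDadd : ∀ w ∈ D, ∀ τ : ℝ, 0 ≤ τ → w + τ ∈ D := by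
    rintro w ⟨h1, h2, h3⟩ τ hτ
    refine ⟨h1.trans (by simpa using norm_add_ofReal_mono h2.le le_rfl hτ),
      by simp; linarith, ?_⟩
    calc ‖w + τ‖ ≤ ‖w‖ + τ := by simpa [abs_of_nonneg hτ] using norm_add_le w (τ : ℂ)
      _ ≤ q * w.re + q * τ := by nlinarith
      _ = _ := by simp; ring
  let S : Set ℝ := (fun w => ‖R (n + 2) a w‖ * ‖w‖ ^ (2 * (n + 1))) '' D
  have hSb : BddAbove S := by
    obtain ⟨C, hC⟩ := sectorBounded (n + 2) a q
    refine ⟨C, ?_⟩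
    rintro _ ⟨w, ⟨h1, h2, h3⟩, rfl⟩
    refine le_trans ?_ (hC w h1 h2 h3)
    exact mul_le_mul_of_nonneg_left (pow_le_pow_right₀ h1 (by omega)) (norm_nonneg _)
  have hSup : ∀ w ∈ D, ‖R (n + 2) a w‖ * ‖w‖ ^ (2 * (n + 1)) ≤ sSup S := fun w hw =>
    le_csSup hSb ⟨w, hw, rfl⟩
  have hM0 : 0 ≤ sSup S := le_trans (by positivity) (hSup z hzD)
  have hstep : ∀ w ∈ D, ‖R (n + 2) a w‖ * ‖w‖ ^ (2 * (n + 1)) ≤ (A + κ * sSup S) / (2 * k) := by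
    intro w hw
    have hw1 : 0 < ‖w‖ := by linarith [hw.1]
    have h := norm_R_le_of_forcing_le n a hm hk0 hn hw.2.1 hw.1 (B := A + κ * sSup S)
      (by positivity) fun τ hτ => ?_
    · rw [show m + k = n + 1 by omega] at h
      exact (le_div_iff₀ (by positivity)).1 h
    · have hD := hDadd w hw τ hτ
      set ζ := w + (τ : ℂ) with hζ
      have hζ0 : 0 < ‖ζ‖ := by linarith [hD.1]
      have hR : ‖R (n + 2) a ζ‖ ≤ sSup S / ‖ζ‖ ^ (2 * (n + 1)) :=
        (le_div_iff₀ (by positivity)).2 (hSup ζ hD)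
      rw [norm_mul, norm_neg, norm_div, hκC, norm_pow]
      calc κ / ‖ζ‖ ^ 2 * ‖pcoef (n + 1) ((a : ℂ) + 2) / ζ ^ (2 * (n + 1)) + R (n + 2) a ζ‖
          ≤ κ / ‖ζ‖ ^ 2 * (‖pcoef (n + 1) ((a : ℂ) + 2)‖ / ‖ζ‖ ^ (2 * (n + 1)) +
            sSup S / ‖ζ‖ ^ (2 * (n + 1))) := by
            gcongr
            refine (norm_add_le _ _).trans (add_le_add (le_of_eq ?_) hR)
            rw [norm_div, norm_pow]
        _ = (κ * ‖pcoef (n + 1) ((a : ℂ) + 2)‖ + κ * sSup S) / ‖ζ‖ ^ (2 * (n + 2)) := by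
            rw [show 2 * (n + 2) = 2 * (n + 1) + 2 by ring, pow_add _ (2 * (n + 1))]
            field_simp
        _ = _ := by rw [hAκ]
  -- The estimate reproduces the supremum with factor κ/(2k) < 1, and the supremum is finite, so it
  -- can be absorbed.
  have hM : sSup S ≤ (A + κ * sSup S) / (2 * k) :=
    csSup_le ⟨_, z, hzD, rfl⟩ (by rintro _ ⟨w, hw, rfl⟩; exact hstep w hw)
  have hk' : (0 : ℝ) < 2 * k := by positivity
  rw [le_div_iff₀ hk'] at hM
  have hM' : sSup S ≤ A / (2 * k - κ) := by
    rw [le_div_iff₀ (by linarith)]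
    linarith
  rw [le_div_iff₀ (by positivity)]
  exact (hSup z hzD).trans hM'

/-! ### The numerical bound -/

/-- The modulus of the term of order `s` of the Poincaré expansion at `a = 10`, `|z| = 12`. -/
def termBound : ℕ → ℝ
  | 0 => 1
  | s + 1 => termBound s * ((21 / 2 + 2 * s) * (23 / 2 + 2 * s) / (288 * (s + 1)))

theorem termBound_nonneg (s : ℕ) : 0 ≤ termBound s := by
  induction s with
  | zero => simp [termBound]
  | succ s ih =>
    rw [termBound]
    positivity

theorem sum_termBound_lt :
    (∑ s ∈ Finset.range 35, termBound (35 + s)) + 140 / (69 / 4) * 144 * termBound 70 <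
      6.24 * (10 : ℝ) ^ (-14 : ℤ) := by
  norm_num [Finset.sum_range_succ, termBound]

theorem norm_pcoef_succ (s : ℕ) (a : ℝ) :
    ‖pcoef (s + 1) a‖ = ‖pcoef s a‖ *
      (|a + 1 / 2 + 2 * s| * |a + 3 / 2 + 2 * s| / (2 * (s + 1))) := by
  have h : pcoef (s + 1) a = pcoef s a *
      ((-((a + 1 / 2 + 2 * s) * (a + 3 / 2 + 2 * s) / (2 * (s + 1))) : ℝ) : ℂ) := by
    have h1 : (s.factorial : ℂ) ≠ 0 := by exact_mod_cast s.factorial_ne_zero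
    have h2 : ((s : ℂ) + 1) ≠ 0 := by exact_mod_cast s.succ_ne_zero
    rw [pcoef, pcoef, show 2 * (s + 1) = 2 * s + 1 + 1 by ring, ascPochhammer_succ_eval,
      ascPochhammer_succ_eval, Nat.factorial_succ]
    push_cast
    field_simp
    ring
  rw [h, norm_mul, Complex.norm_real, norm_neg, norm_div, norm_mul, Real.norm_eq_abs,
    Real.norm_eq_abs, Real.norm_of_nonneg (by positivity : (0 : ℝ) ≤ 2 * (s + 1))]

theorem norm_pcoef_div_le {a : ℝ} (ha : |a| ≤ 10) (s : ℕ) :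
    ‖pcoef s a‖ / 12 ^ (2 * s) ≤ termBound s := by
  obtain ⟨h1, h2⟩ := abs_le.1 ha
  induction s with
  | zero => simp [pcoef, termBound]
  | succ s ih =>
    have hs : (0 : ℝ) ≤ s := Nat.cast_nonneg s
    have e1 : |a + 1 / 2 + 2 * s| ≤ 21 / 2 + 2 * s := abs_le.2 ⟨by linarith, by linarith⟩
    have e2 : |a + 3 / 2 + 2 * s| ≤ 23 / 2 + 2 * s := abs_le.2 ⟨by linarith, by linarith⟩
    calc ‖pcoef (s + 1) a‖ / 12 ^ (2 * (s + 1))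
        = ‖pcoef s a‖ / 12 ^ (2 * s) *
          (|a + 1 / 2 + 2 * s| * |a + 3 / 2 + 2 * s| / (288 * (s + 1))) := by
          rw [norm_pcoef_succ, show 2 * (s + 1) = 2 * s + 2 by ring, pow_add _ (2 * s)]
          field_simp
          ring
      _ ≤ termBound s * ((21 / 2 + 2 * s) * (23 / 2 + 2 * s) / (288 * (s + 1))) := by
          have := termBound_nonneg s
          gcongr

theorem R_eq_sum_add (n j : ℕ) (a z : ℂ) :
    R n a z = ∑ s ∈ Finset.range j, pcoef (n + s) a / z ^ (2 * (n + s)) + R (n + j) a z := by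
  induction j with
  | zero => simp
  | succ j ih =>
    rw [ih, Finset.sum_range_succ, ← add_assoc n j 1, R_succ]
    ring

/-- Order 70 makes 2k exceed κ for all |a| ≤ 10. The factor 144 = 12² is the power of |z| lost in
`norm_R_le`. -/
theorem norm_R_seventy_le {a : ℝ} (ha : |a| ≤ 10) {z : ℂ} (hz : 0 < z.re) (hz12 : 12 ≤ ‖z‖) :
    ‖R 70 a z‖ ≤ 140 / (69 / 4) * 144 * termBound 70 := by
  obtain ⟨h1, h2⟩ := abs_le.1 ha
  have hz0 : 0 < ‖z‖ := by linarith
  have key : ∃ d : ℝ, 69 / 4 ≤ d ∧ ‖R 70 a z‖ ≤ 140 * ‖pcoef 70 a‖ / d / ‖z‖ ^ 138 := by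
    rcases le_or_gt 0 (a + 1 / 2) with hc | hc
    · have hκ : |(a + 1 / 2) * (a + 3 / 2)| ≤ 483 / 4 := by
        rw [abs_of_nonneg (by nlinarith)]
        nlinarith
      -- Here the weight decreases, so m = 0 and 2k = 138; the worst margin is 138 - 483/4 = 69/4,
      -- at a = 10.
      have h := norm_R_le 68 a (m := 0) (k := 69) (by simpa using hc) rfl
        (by push_cast; linarith) hz (by linarith)
      exact ⟨138 - |(a + 1 / 2) * (a + 3 / 2)|, by linarith, h.trans (le_of_eq (by norm_num))⟩
    · have hκ : |(a + 1 / 2) * (a + 3 / 2)| ≤ 323 / 4 := abs_le.2 ⟨by nlinarith, by nlinarith⟩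
      -- Here -(a+1/2) ≤ 19/2, so m = 10 suffices; then 2k = 118, and κ ≤ 323/4 leaves a larger
      -- margin than 69/4.
      have h := norm_R_le 68 a (m := 10) (k := 59) (by push_cast; linarith) rfl
        (by push_cast; linarith) hz (by linarith)
      exact ⟨118 - |(a + 1 / 2) * (a + 3 / 2)|, by linarith, h.trans (le_of_eq (by norm_num))⟩
  obtain ⟨d, hd, h⟩ := key
  have hp := norm_pcoef_div_le ha 70
  calc ‖R 70 a z‖ ≤ 140 * ‖pcoef 70 a‖ / d / ‖z‖ ^ 138 := h
    _ ≤ 140 * ‖pcoef 70 a‖ / (69 / 4) / 12 ^ 138 := by gcongr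
    _ = 140 / (69 / 4) * 144 * (‖pcoef 70 a‖ / 12 ^ (2 * 70)) := by
        rw [show (12 : ℝ) ^ (2 * 70) = 144 * 12 ^ 138 by norm_num]
        ring
    _ ≤ _ := by gcongr

theorem norm_R_le_of_re_pos {a : ℝ} (ha : |a| ≤ 10) {z : ℂ} (hz : 0 < z.re) (hz12 : 12 ≤ ‖z‖) :
    ‖R 35 a z‖ ≤ (∑ s ∈ Finset.range 35, termBound (35 + s)) +
      140 / (69 / 4) * 144 * termBound 70 := by
  rw [R_eq_sum_add 35 35]
  refine (norm_add_le _ _).trans (add_le_add ?_ (norm_R_seventy_le ha hz hz12))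
  refine (norm_sum_le _ _).trans (Finset.sum_le_sum fun s _ => ?_)
  rw [norm_div, norm_pow]
  refine le_trans ?_ (norm_pcoef_div_le ha (35 + s))
  gcongr

theorem norm_R_le_of_re_nonneg {a : ℝ} (ha : |a| ≤ 10) {z : ℂ} (hz : 0 ≤ z.re)
    (hz12 : 12 ≤ ‖z‖) :
    ‖R 35 a z‖ ≤ (∑ s ∈ Finset.range 35, termBound (35 + s)) +
      140 / (69 / 4) * 144 * termBound 70 := by
  have hslit : z ∈ Complex.slitPlane := by
    rcases hz.lt_or_eq with h | h
    · exact Or.inl h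
    · refine Or.inr fun him => ?_
      have : z = 0 := Complex.ext h.symm him
      norm_num [this] at hz12
  -- The bound in the open half-plane is uniform up to the imaginary axis, and R is continuous there
  -- because z ≠ 0 lies off the cut.
  have hc : ContinuousAt (R 35 a) z := (hasDerivAt_R 34 a hslit).continuousAt
  have ht : Tendsto (fun ε : ℝ => z + ε) (𝓝[>] 0) (𝓝 z) := by
    have : ContinuousAt (fun ε : ℝ => z + (ε : ℂ)) 0 := by fun_prop
    simpa using this.tendsto.mono_left nhdsWithin_le_nhds
  refine le_of_tendsto ((hc.tendsto.comp ht).norm) ?_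
  filter_upwards [self_mem_nhdsWithin] with ε hε
  have hε' : (0 : ℝ) < ε := hε
  exact norm_R_le_of_re_pos ha (by simp; linarith)
    (hz12.trans (by simpa using norm_add_ofReal_mono hz le_rfl hε'.le))

end ParabolicCylinder

end

theorem theorem1 (a : ℝ) (ha : |a| ≤ 10) (z : ℂ) (hz : 12 ≤ ‖z‖)
    (harg : |Complex.arg z| ≤ Real.pi / 2) :
    ‖ParabolicCylinder.R 35 (a : ℂ) z‖ < 6.24 * (10 : ℝ) ^ (-14 : ℤ) := by
  exact (ParabolicCylinder.norm_R_le_of_re_nonneg ha (Complex.abs_arg_le_pi_div_two_iff.1 harg)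
    hz).trans_lt ParabolicCylinder.sum_termBound_lt
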